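/- Let $\mathbf k$ be a field of characteristic zero. A Poisson algebra is a commutative unital $\mathbf k$-algebra $R$ with a $\mathbf k$-bilinear Lie bracket $\{-,-\}$ such that every $\{a,-\}$ is a derivation. Its Poisson enveloping algebra $R^e$ is the unital $\mathbf k$-algebra with maps $i,\mathrm d:R\to R^e$, universal among such triples with $i$ an algebra homomorphism, $\mathrm d$ $\mathbf k$-linear, and $$\mathrm d\{a,b\}=[\mathrm da,\mathrm db],\qquad i(\{a,b\})=[\mathrm da,i(b)],\qquad \mathrm d(ab)=i(a)\,\mathrm db+i(b)\,\mathrm da ;$$ we write $a$ for $i(a)$. Let $S$ be a subalgebra of a $\mathbf k$-algebra $T$ and let $y_1,y_2\in T$ be such that $T$ is generated by $S,y_1,y_2$. $T$ is a *left double extension* of $S$ if (i) $y_2y_1=p_{11}y_1^2+p_{12}y_1y_2+\tau_1y_1+\tau_2y_2+\tau_0$ for some $P=(p_{11},p_{12})\in\mathbf k^2$, $\tau=(\tau_1,\tau_2,\tau_0)\in S^3$; (ii) $T$ is a free left $S$-module with basis $\{y_1^iy_2^j\}_{i,j\ge0}$; (iii) $y_1S+y_2S+S\subseteq Sy_1+Sy_2+S$.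 It has DE-data $\{P,\sigma,\delta,\tau\}$, where $\sigma:S\to M_{2\times2}(S)$ and $\delta:S\to M_{2\times1}(S)$ are $\mathbf k$-linear, if (i) holds with $P,\tau$ and $$\begin{pmatrix}y_1\\y_2\end{pmatrix}a=\sigma(a)\begin{pmatrix}y_1\\y_2\end{pmatrix}+\delta(a)\qquad(a\in S);$$ one then writes $T=S[y_1,y_2;\sigma,\delta]$. $T$ is a *right double extension* of $S$ if symmetrically $y_1y_2=p'_{11}y_1^2+p'_{12}y_2y_1+y_1\tau'_1+y_2\tau'_2+\tau'_0$ for some $p'_{11},p'_{12}\in\mathbf k$, $\tau'_1,\tau'_2,\tau'_0\in S$; $T$ is a free right $S$-module with basis $\{y_2^iy_1^j\}_{i,j\ge0}$; and $Sy_1+Sy_2+S\subseteq y_1S+y_2S+S$. $T$ is a *double extension* of $S$ if it is both, with the same $y_1,y_2$. **Theorem.** Let $R$ be a Poisson algebra with bracket $\{-,-\}_R$ and let $A=R[x_1,x_2;\alpha,\nu]_p$ be a double Poisson-Ore extension of $R$ with data $Q=(q_{11},q_{12})\in\mathbf k^2$, $\alpha=(\alpha_{kl}):R\to M_{2\times2}(R)$,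 $\nu=(\nu_k):R\to M_{2\times1}(R)$, $w=(w_1,w_2,w_0)\in R^3$; that is, $A$ is the commutative polynomial ring $R[x_1,x_2]$ with a Poisson bracket satisfying $$\{a,b\}=\{a,b\}_R,\qquad \{x_2,x_1\}=f:=q_{11}x_1^2+q_{12}x_1x_2+w_1x_1+w_2x_2+w_0,\qquad \{x_k,a\}=\alpha_{k1}(a)x_1+\alpha_{k2}(a)x_2+\nu_k(a)$$ for all $a,b\in R$, $k=1,2$. Put $y_k=\mathrm dx_k\in A^e$ and let $B$ be the subalgebra of $A^e$ generated by the image of the canonical map $R^e\to A^e$ and by $x_1,x_2$. Then the canonical map $R^e\to B$ is injective, $B$ is a double extension of $R^e$ in the variables $x_1,x_2$, and $A^e$ is a double extension of $B$ in the variables $y_1,y_2$: $$A^e=R^e[x_1,x_2;\sigma^1,\delta^1][y_1,y_2;\sigma^2,\delta^2].$$ The DE-data $\{P^1,\sigma^1,\delta^1,\tau^1\}$ of $B$ over $R^e$ satisfy $P^1=(0,1)$, $\tau^1=(0,0,0)$ and, for all $a\in R$, $$\sigma^1(a)=\begin{pmatrix}a&0\\0&a\end{pmatrix},\quad \sigma^1(\mathrm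 da)=\begin{pmatrix}\alpha_{11}(a)+\mathrm da&\alpha_{12}(a)\\ \alpha_{21}(a)&\alpha_{22}(a)+\mathrm da\end{pmatrix},\quad \delta^1(a)=\begin{pmatrix}0\\0\end{pmatrix},\quad \delta^1(\mathrm da)=\begin{pmatrix}\nu_1(a)\\ \nu_2(a)\end{pmatrix}.$$ The DE-data $\{P^2,\sigma^2,\delta^2,\tau^2\}$ of $A^e$ over $B$ satisfy $P^2=(0,1)$, $$\tau^2=(2q_{11}x_1+q_{12}x_2+w_1,\ q_{12}x_1+w_2,\ x_1\mathrm dw_1+x_2\mathrm dw_2+\mathrm dw_0)$$ and, for all $a\in R$, $$\sigma^2(a)=\begin{pmatrix}a&0\\0&a\end{pmatrix},\quad \sigma^2(\mathrm da)=\begin{pmatrix}\alpha_{11}(a)+\mathrm da&\alpha_{12}(a)\\ \alpha_{21}(a)&\alpha_{22}(a)+\mathrm da\end{pmatrix},\quad \sigma^2(x_k)=\begin{pmatrix}x_k&0\\0&x_k\end{pmatrix}\ (k=1,2),$$ $$\delta^2(a)=\begin{pmatrix}\alpha_{11}(a)x_1+\alpha_{12}(a)x_2+\nu_1(a)\\ \alpha_{21}(a)x_1+\alpha_{22}(a)x_2+\nu_2(a)\end{pmatrix},\quad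 \delta^2(\mathrm da)=\begin{pmatrix}x_1\mathrm d\alpha_{11}(a)+x_2\mathrm d\alpha_{12}(a)+\mathrm d\nu_1(a)\\ x_1\mathrm d\alpha_{21}(a)+x_2\mathrm d\alpha_{22}(a)+\mathrm d\nu_2(a)\end{pmatrix},$$ $$\delta^2(x_1)=\begin{pmatrix}0\\ f\end{pmatrix},\qquad \delta^2(x_2)=\begin{pmatrix}-f\\0\end{pmatrix}.$$ -/

import Mathlib

/-- A Poisson bracket on a commutative `k`-algebra `R`: a `k`-bilinear map which is a Lie bracket
(alternating, with the Jacobi identity) and for which every hamiltonian map `{a, -}` is a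
derivation.  A Poisson algebra is a commutative `k`-algebra with such a bracket.  (The class
`Bracket` is not used, because on a ring it denotes the commutator.) -/
structure PoissonBracket (k R : Type*) [CommRing k] [CommRing R] [Algebra k R] where
  /-- the bracket `{a, b}` -/
  br : R →ₗ[k] R →ₗ[k] R
  br_self : ∀ a, br a a = 0
  jacobi : ∀ a b c, br a (br b c) + br b (br c a) + br c (br a b) = 0
  leibniz : ∀ a b c, br a (b * c) = b * br a c + c * br a b

/-- The pair `(γ, δ)` satisfies property **P** from the Poisson algebra `R` into the algebra `U`:
`γ` is an algebra homomorphism, `δ` is a homomorphism of Lie algebras from `(R, {-,-})` to `U`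
with the commutator, `γ({a,b}) = [δ(a), γ(b)]` and `δ(ab) = γ(a)δ(b) + γ(b)δ(a)`. -/
structure SatisfiesP {k R U : Type*} [CommRing k] [CommRing R] [Algebra k R] [Ring U] [Algebra k U]
    (π : PoissonBracket k R) (γ : R →ₐ[k] U) (δ : R →ₗ[k] U) : Prop where
  lie : ∀ a b, δ (π.br a b) = δ a * δ b - δ b * δ a
  bracket : ∀ a b, γ (π.br a b) = δ a * γ b - γ b * δ a
  mul : ∀ a b, δ (a * b) = γ a * δ b + γ b * δ a

/-- Defining relations of the Poisson enveloping algebra.  The free generator `Sum.inl a` is the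
image of `a`, the free generator `Sum.inr a` is `da`. -/
inductive PoissonEnvRel {k R : Type*} [CommRing k] [CommRing R] [Algebra k R]
    (π : PoissonBracket k R) : FreeAlgebra k (R ⊕ R) → FreeAlgebra k (R ⊕ R) → Prop
  | i_algebraMap (c : k) : PoissonEnvRel π (FreeAlgebra.ι k (Sum.inl (algebraMap k R c)))
      (algebraMap k (FreeAlgebra k (R ⊕ R)) c)
  | i_add (a b : R) : PoissonEnvRel π (FreeAlgebra.ι k (Sum.inl (a + b)))
      (FreeAlgebra.ι k (Sum.inl a) + FreeAlgebra.ι k (Sum.inl b))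
  | i_mul (a b : R) : PoissonEnvRel π (FreeAlgebra.ι k (Sum.inl (a * b)))
      (FreeAlgebra.ι k (Sum.inl a) * FreeAlgebra.ι k (Sum.inl b))
  | d_add (a b : R) : PoissonEnvRel π (FreeAlgebra.ι k (Sum.inr (a + b)))
      (FreeAlgebra.ι k (Sum.inr a) + FreeAlgebra.ι k (Sum.inr b))
  | d_smul (c : k) (a : R) : PoissonEnvRel π (FreeAlgebra.ι k (Sum.inr (c • a)))
      (c • FreeAlgebra.ι k (Sum.inr a))
  | lie (a b : R) : PoissonEnvRel π (FreeAlgebra.ι k (Sum.inr (π.br a b)))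
      (FreeAlgebra.ι k (Sum.inr a) * FreeAlgebra.ι k (Sum.inr b)
        - FreeAlgebra.ι k (Sum.inr b) * FreeAlgebra.ι k (Sum.inr a))
  | bracket (a b : R) : PoissonEnvRel π (FreeAlgebra.ι k (Sum.inl (π.br a b)))
      (FreeAlgebra.ι k (Sum.inr a) * FreeAlgebra.ι k (Sum.inl b)
        - FreeAlgebra.ι k (Sum.inl b) * FreeAlgebra.ι k (Sum.inr a))
  | d_mul (a b : R) : PoissonEnvRel π (FreeAlgebra.ι k (Sum.inr (a * b)))
      (FreeAlgebra.ι k (Sum.inl a) * FreeAlgebra.ι k (Sum.inr b)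
        + FreeAlgebra.ι k (Sum.inl b) * FreeAlgebra.ι k (Sum.inr a))

/-- The Poisson enveloping algebra `R^e` of a Poisson algebra `R`, by generators and relations;
`PoissonEnv.universal` below is its defining universal property. -/
def PoissonEnv {k R : Type*} [CommRing k] [CommRing R] [Algebra k R]
    (π : PoissonBracket k R) : Type _ :=
  RingQuot (PoissonEnvRel π)

namespace PoissonEnv

variable {k R : Type*} [CommRing k] [CommRing R] [Algebra k R]

noncomputable instance (π : PoissonBracket k R) : Ring (PoissonEnv π) :=
  inferInstanceAs (Ring (RingQuot (PoissonEnvRel π)))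

noncomputable instance (π : PoissonBracket k R) : Algebra k (PoissonEnv π) :=
  inferInstanceAs (Algebra k (RingQuot (PoissonEnvRel π)))

/-- The quotient map from the free algebra to `R^e`. -/
noncomputable def mk (π : PoissonBracket k R) : FreeAlgebra k (R ⊕ R) →ₐ[k] PoissonEnv π :=
  RingQuot.mkAlgHom k (PoissonEnvRel π)

theorem mk_rel {π : PoissonBracket k R} {x y : FreeAlgebra k (R ⊕ R)}
    (h : PoissonEnvRel π x y) : mk π x = mk π y :=
  RingQuot.mkAlgHom_rel k h

/-- The canonical algebra homomorphism `i : R → R^e`. -/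
noncomputable def i (π : PoissonBracket k R) : R →ₐ[k] PoissonEnv π :=
  AlgHom.ofLinearMap
    { toFun := fun a => mk π (FreeAlgebra.ι k (Sum.inl a))
      map_add' := fun a b => by
        rw [mk_rel (PoissonEnvRel.i_add a b), map_add]
      map_smul' := fun c a => by
        rw [Algebra.smul_def c a, mk_rel (PoissonEnvRel.i_mul _ a), map_mul,
          mk_rel (PoissonEnvRel.i_algebraMap c), AlgHom.commutes,
          RingHom.id_apply, Algebra.smul_def] }
    (by
      have h := mk_rel (PoissonEnvRel.i_algebraMap (π := π) (1 : k))
      rw [map_one, map_one, map_one] at h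
      exact h)
    (fun a b => by
      have h := mk_rel (PoissonEnvRel.i_mul (π := π) a b)
      rw [map_mul] at h
      exact h)

/-- The canonical map `d : R → R^e`. -/
noncomputable def d (π : PoissonBracket k R) : R →ₗ[k] PoissonEnv π where
  toFun a := mk π (FreeAlgebra.ι k (Sum.inr a))
  map_add' a b := by rw [mk_rel (PoissonEnvRel.d_add a b), map_add]
  map_smul' c a := by
    rw [mk_rel (PoissonEnvRel.d_smul c a), map_smul, RingHom.id_apply]

theorem satisfiesP (π : PoissonBracket k R) : SatisfiesP π (i π) (d π) where
  lie a b := by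
    have h := mk_rel (PoissonEnvRel.lie (π := π) a b)
    rw [map_sub, map_mul, map_mul] at h
    exact h
  bracket a b := by
    have h := mk_rel (PoissonEnvRel.bracket (π := π) a b)
    rw [map_sub, map_mul, map_mul] at h
    exact h
  mul a b := by
    have h := mk_rel (PoissonEnvRel.d_mul (π := π) a b)
    rw [map_add, map_mul, map_mul] at h
    exact h

/-- The algebra homomorphism `R^e → T` induced by a pair `(γ, δ)` with property **P**. -/
noncomputable def lift {T : Type*} [Ring T] [Algebra k T] {π : PoissonBracket k R}
    (γ : R →ₐ[k] T) (δ : R →ₗ[k] T) (h : SatisfiesP π γ δ) : PoissonEnv π →ₐ[k] T :=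
  RingQuot.liftAlgHom k ⟨FreeAlgebra.lift k (Sum.elim γ δ), fun x y hxy => by
    induction hxy with
    | i_algebraMap c => simp
    | i_add a b => simp
    | i_mul a b => simp
    | d_add a b => simp
    | d_smul c a => simp
    | lie a b => simp [h.lie]
    | bracket a b => simp [h.bracket]
    | d_mul a b => simp [h.mul]⟩

theorem lift_mk {T : Type*} [Ring T] [Algebra k T] {π : PoissonBracket k R}
    (γ : R →ₐ[k] T) (δ : R →ₗ[k] T) (h : SatisfiesP π γ δ) (z : FreeAlgebra k (R ⊕ R)) :
    lift γ δ h (mk π z) = FreeAlgebra.lift k (Sum.elim γ δ) z :=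
  RingQuot.liftAlgHom_mkAlgHom_apply k _ _ _

theorem lift_i {T : Type*} [Ring T] [Algebra k T] {π : PoissonBracket k R}
    (γ : R →ₐ[k] T) (δ : R →ₗ[k] T) (h : SatisfiesP π γ δ) (a : R) :
    lift γ δ h (i π a) = γ a := by
  change lift γ δ h (mk π (FreeAlgebra.ι k (Sum.inl a))) = γ a
  simp [lift_mk]

theorem lift_d {T : Type*} [Ring T] [Algebra k T] {π : PoissonBracket k R}
    (γ : R →ₐ[k] T) (δ : R →ₗ[k] T) (h : SatisfiesP π γ δ) (a : R) :
    lift γ δ h (d π a) = δ a := by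
  change lift γ δ h (mk π (FreeAlgebra.ι k (Sum.inr a))) = δ a
  simp [lift_mk]

/-- The universal property of `(R^e, i, d)`, for target algebras in every universe. -/
theorem universal {T : Type*} [Ring T] [Algebra k T] (π : PoissonBracket k R)
    (γ : R →ₐ[k] T) (δ : R →ₗ[k] T) (h : SatisfiesP π γ δ) :
    ∃! f : PoissonEnv π →ₐ[k] T, (∀ a, f (i π a) = γ a) ∧ (∀ a, f (d π a) = δ a) := by
  refine ⟨lift γ δ h, ⟨lift_i γ δ h, lift_d γ δ h⟩, ?_⟩
  rintro f ⟨hi, hd⟩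
  apply RingQuot.ringQuot_ext'
  apply FreeAlgebra.hom_ext
  funext a
  rcases a with a | a
  · exact (hi a).trans (lift_i γ δ h a).symm
  · exact (hd a).trans (lift_d γ δ h a).symm

/-- A homomorphism `f : R → S` of Poisson algebras gives a pair with property **P** from `R`
into `S^e`. -/
theorem satisfiesP_comp {S : Type*} [CommRing S] [Algebra k S] {π : PoissonBracket k R}
    {ρ : PoissonBracket k S} (f : R →ₐ[k] S) (hf : ∀ a b, f (π.br a b) = ρ.br (f a) (f b)) :
    SatisfiesP π ((i ρ).comp f) ((d ρ).comp f.toLinearMap) where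
  lie a b := by simp [hf, (satisfiesP ρ).lie]
  bracket a b := by simp [hf, (satisfiesP ρ).bracket]
  mul a b := by simp [(satisfiesP ρ).mul]

/-- The homomorphism `R^e → S^e`, `i a ↦ i (f a)`, `d a ↦ d (f a)`, induced by a homomorphism
`f : R → S` of Poisson algebras. -/
noncomputable def map {S : Type*} [CommRing S] [Algebra k S] {π : PoissonBracket k R}
    {ρ : PoissonBracket k S} (f : R →ₐ[k] S) (hf : ∀ a b, f (π.br a b) = ρ.br (f a) (f b)) :
    PoissonEnv π →ₐ[k] PoissonEnv ρ :=
  lift ((i ρ).comp f) ((d ρ).comp f.toLinearMap) (satisfiesP_comp f hf)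

end PoissonEnv

section DoubleExtension

variable {F S T : Type*} [CommRing F] [Ring S] [Algebra F S] [Ring T] [Algebra F T]

/-- `T` is a left double (Ore) extension of its subalgebra `S` (embedded by `j`) with the new
variables `y₁ = y 0` and `y₂ = y 1`. -/
structure IsLeftDoubleExtension (j : S →ₐ[F] T) (y : Fin 2 → T) : Prop where
  injective : Function.Injective j
  generates : Algebra.adjoin F (Set.range j ∪ {y 0, y 1}) = ⊤
  relation : ∃ (p₁₁ p₁₂ : F) (τ₁ τ₂ τ₀ : S),
    y 1 * y 0 = p₁₁ • (y 0) ^ 2 + p₁₂ • (y 0 * y 1) + j τ₁ * y 0 + j τ₂ * y 1 + j τ₀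
  /-- `T` is a free left `S`-module with basis `{y₁ ^ m * y₂ ^ n}`: every element is a finite left
  linear combination of these in exactly one way. -/
  basis : Function.Bijective
    (fun c : ℕ × ℕ →₀ S => c.sum fun p s => j s * (y 0 ^ p.1 * y 1 ^ p.2))
  /-- `y₁ S + y₂ S + S ⊆ S y₁ + S y₂ + S` -/
  subset : ∀ a b c : S, ∃ a' b' c' : S,
    y 0 * j a + y 1 * j b + j c = j a' * y 0 + j b' * y 1 + j c'

/-- `T` is a right double (Ore) extension of its subalgebra `S` (embedded by `j`) with the new
variables `y₁ = y 0` and `y₂ = y 1`: the mirror image of `IsLeftDoubleExtension`. -/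
structure IsRightDoubleExtension (j : S →ₐ[F] T) (y : Fin 2 → T) : Prop where
  injective : Function.Injective j
  generates : Algebra.adjoin F (Set.range j ∪ {y 0, y 1}) = ⊤
  relation : ∃ (p₁₁ p₁₂ : F) (τ₁ τ₂ τ₀ : S),
    y 0 * y 1 = p₁₁ • (y 0) ^ 2 + p₁₂ • (y 1 * y 0) + y 0 * j τ₁ + y 1 * j τ₂ + j τ₀
  /-- `T` is a free right `S`-module with basis `{y₂ ^ m * y₁ ^ n}`. -/
  basis : Function.Bijective
    (fun c : ℕ × ℕ →₀ S => c.sum fun p s => (y 1 ^ p.1 * y 0 ^ p.2) * j s)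
  /-- `S y₁ + S y₂ + S ⊆ y₁ S + y₂ S + S` -/
  subset : ∀ a b c : S, ∃ a' b' c' : S,
    j a * y 0 + j b * y 1 + j c = y 0 * j a' + y 1 * j b' + j c'

/-- `T` is a double (Ore) extension of `S`: a left and a right double extension with the same
new variables. -/
structure IsDoubleExtension (j : S →ₐ[F] T) (y : Fin 2 → T) : Prop where
  left : IsLeftDoubleExtension j y
  right : IsRightDoubleExtension j y

/-- The left double extension `T` of `S` has the DE-data `{P, σ, δ, τ}`, where `P = (p₁₁, p₁₂)`
and `τ = (τ₁, τ₂, τ₀)`: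
`y₂ y₁ = p₁₁ y₁² + p₁₂ y₁ y₂ + τ₁ y₁ + τ₂ y₂ + τ₀` and `y a = σ(a) y + δ(a)` for all `a ∈ S`. -/
structure HasDEData (j : S →ₐ[F] T) (y : Fin 2 → T) (P : F × F)
    (σ : S →ₗ[F] Matrix (Fin 2) (Fin 2) S) (δ : S →ₗ[F] (Fin 2 → S)) (τ : S × S × S) : Prop where
  relation : y 1 * y 0 = P.1 • (y 0) ^ 2 + P.2 • (y 0 * y 1)
    + j τ.1 * y 0 + j τ.2.1 * y 1 + j τ.2.2
  commutation : ∀ (a : S) (r : Fin 2),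
    y r * j a = j (σ a r 0) * y 0 + j (σ a r 1) * y 1 + j (δ a r)

end DoubleExtension

section DoublePoissonOre

variable {k R : Type*} [CommRing k] [CommRing R] [Algebra k R]

/-- The polynomial `q₁₁ x₁² + q₁₂ x₁ x₂ + w₁ x₁ + w₂ x₂ + w₀` in an algebra `B` with given
elements `x₁ = x 0`, `x₂ = x 1` and a given map `i : R → B`; here `Q = (q₁₁, q₁₂)` and
`w = (w₁, w₂, w₀)`. -/
def quadraticPart {B : Type*} [Ring B] [Algebra k B] (i : R →ₐ[k] B) (x : Fin 2 → B)
    (Q : k × k) (w : R × R × R) : B :=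
  Q.1 • (x 0) ^ 2 + Q.2 • (x 0 * x 1) + i w.1 * x 0 + i w.2.1 * x 1 + i w.2.2

/-- The inclusion of `R` in the polynomial ring `R[x₁, x₂]`, as a map of `k`-algebras. -/
noncomputable def polyC (k R : Type*) [CommRing k] [CommRing R] [Algebra k R] :
    R →ₐ[k] MvPolynomial (Fin 2) R :=
  IsScalarTower.toAlgHom k R (MvPolynomial (Fin 2) R)

/-- The Poisson algebra `A = R[x₁, x₂]` with bracket `πA` is the double Poisson-Ore extension
`R[x₁, x₂; α, ν]_p` of the Poisson algebra `R` with DE-data `{Q, α, ν, w}`. -/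
structure IsDoublePoissonOre (πR : PoissonBracket k R)
    (πA : PoissonBracket k (MvPolynomial (Fin 2) R))
    (Q : k × k) (α : R → Matrix (Fin 2) (Fin 2) R) (ν : R → Fin 2 → R) (w : R × R × R) :
    Prop where
  br_base : ∀ a b : R, polyC k R (πR.br a b) = πA.br (polyC k R a) (polyC k R b)
  br_vars : πA.br (MvPolynomial.X 1) (MvPolynomial.X 0) =
    quadraticPart (polyC k R) MvPolynomial.X Q w
  br_mixed : ∀ (a : R) (r : Fin 2), πA.br (MvPolynomial.X r) (polyC k R a) =
    polyC k R (α a r 0) * MvPolynomial.X 0 + polyC k R (α a r 1) * MvPolynomial.X 1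
      + polyC k R (ν a r)

namespace IsDoublePoissonOre

variable {πR : PoissonBracket k R} {πA : PoissonBracket k (MvPolynomial (Fin 2) R)}
  {Q : k × k} {α : R → Matrix (Fin 2) (Fin 2) R} {ν : R → Fin 2 → R} {w : R × R × R}

/-- The canonical homomorphism `R^e → A^e`. -/
noncomputable def envMap (h : IsDoublePoissonOre πR πA Q α ν w) :
    PoissonEnv πR →ₐ[k] PoissonEnv πA :=
  PoissonEnv.map (polyC k R) h.br_base

/-- The subalgebra `B` of `A^e` generated by (the image of) `R^e` and `x₁, x₂`. -/
noncomputable def mid (h : IsDoublePoissonOre πR πA Q α ν w) : Subalgebra k (PoissonEnv πA) :=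
  Algebra.adjoin k (Set.range h.envMap ∪
    {PoissonEnv.i πA (MvPolynomial.X 0), PoissonEnv.i πA (MvPolynomial.X 1)})

/-- The canonical homomorphism `R^e → B`. -/
noncomputable def toMid (h : IsDoublePoissonOre πR πA Q α ν w) : PoissonEnv πR →ₐ[k] h.mid :=
  h.envMap.codRestrict h.mid fun a => Algebra.subset_adjoin (Or.inl ⟨a, rfl⟩)

/-- The elements `x₁, x₂` of `B`. -/
noncomputable def x (h : IsDoublePoissonOre πR πA Q α ν w) : Fin 2 → h.mid :=
  ![⟨PoissonEnv.i πA (MvPolynomial.X 0), Algebra.subset_adjoin (Or.inr (Or.inl rfl))⟩,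
    ⟨PoissonEnv.i πA (MvPolynomial.X 1), Algebra.subset_adjoin (Or.inr (Or.inr rfl))⟩]

/-- The elements `y₁ = d x₁, y₂ = d x₂` of `A^e`. -/
noncomputable def y (_h : IsDoublePoissonOre πR πA Q α ν w) : Fin 2 → PoissonEnv πA :=
  ![PoissonEnv.d πA (MvPolynomial.X 0), PoissonEnv.d πA (MvPolynomial.X 1)]

/-- The image in `B` of an element `a` of `R`. -/
noncomputable def iB (h : IsDoublePoissonOre πR πA Q α ν w) : R →ₐ[k] h.mid :=
  h.toMid.comp (PoissonEnv.i πR)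

/-- The image in `B` of the element `da` of `R^e`. -/
noncomputable def dB (h : IsDoublePoissonOre πR πA Q α ν w) : R →ₗ[k] h.mid :=
  h.toMid.toLinearMap.comp (PoissonEnv.d πR)

end IsDoublePoissonOre

end DoublePoissonOre

/-! `B` is given only as a subalgebra of `A^e`, so it is first replaced by an abstract algebra:
`RelPoissonEnv`, presented by `A` and the symbols `da` with `a ∈ R`, and the relations among them.
The relations rewrite every element into normal form; the substance is the linear independence of
the normal forms, which is proved both times by a faithful action.

Over `R^e`, the relative algebra acts on `A ⊗[R] R^e` by `da (p ⊗ u) = {a, p} ⊗ u + p ⊗ da u`.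
Evaluation at `1 ⊗ 1` sends `p * s` to `p ⊗ s`, so the monomials in `x₁, x₂` form a right basis
(`relEnv_basis_injective`, `relEnv_basis_surjective`).

Over the relative algebra, `A^e` must act on the free module on the symbols `y₁ ^ m y₂ ^ n`. The
rules moving `y₁, y₂` past coefficients form an algebra homomorphism into block triangular 3 × 3
matrices; that it respects the relations is the Jacobi identity (`satisfiesRelP_cross`). They define
operators `varOp` in which the quadratic relation holds on basis vectors by construction. It holds
everywhere because its defect `Ω` satisfies `Ω u = v Ω` for each coefficient `u` and some `v`
(`lieDefect_X_X_mul`, `exists_lieDefect_mul`). The defect `[δp, δq] - δ{p, q}` is a skew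
biderivation, so its vanishing on generators yields the action of `A^e`. Hence `A^e` is left free
over the relative algebra, which therefore embeds in `A^e` with image `B`.

This gives the right half of the first extension and the left half of the second. The other halves
follow by symmetry: reversing the sign of the bracket replaces the enveloping algebra by its
opposite (`opEquiv`), and the hypotheses are stable under this change. Finally, freeness makes the
coefficients of `y₁, y₂, 1` unique, so the DE-data are read off from commutation relations on
generators. -/

/-! ### Elementary bracket identities and the opposite bracket -/

namespace PoissonBracket

variable {k R : Type*} [CommRing k] [CommRing R] [Algebra k R] (π : PoissonBracket k R)

theorem br_skew (a b : R) : π.br a b = -π.br b a := by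
  have h := π.br_self (a + b)
  simp only [map_add, LinearMap.add_apply, π.br_self, zero_add, add_zero] at h
  exact eq_neg_of_add_eq_zero_right h

theorem br_mul_left (a b c : R) : π.br (a * b) c = a * π.br b c + b * π.br a c := by
  rw [br_skew, π.leibniz, π.br_skew c a, π.br_skew c b]
  ring

theorem br_br (a b c : R) : π.br a (π.br b c) = π.br (π.br a b) c + π.br b (π.br a c) := by
  have h := π.jacobi a b c
  rw [π.br_skew c (π.br a b), π.br_skew c a, map_neg] at h
  linear_combination h

theorem br_one (a : R) : π.br a 1 = 0 := by
  have h := π.leibniz a 1 1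
  simp only [one_mul] at h
  simpa using h

/-- The opposite Poisson bracket `-{a, b}`. -/
def neg : PoissonBracket k R where
  br := -π.br
  br_self a := by simp [π.br_self]
  jacobi a b c := by
    simpa using π.jacobi a b c
  leibniz a b c := by
    simp only [LinearMap.neg_apply, π.leibniz]
    ring

@[simp] theorem neg_br (a b : R) : π.neg.br a b = -π.br a b := rfl

end PoissonBracket

/-! ### The relative Poisson enveloping algebra -/

/-- The pair `(γ, δ)`, consisting of an algebra homomorphism on a Poisson algebra `A` and a linear
map on a Poisson algebra `R` with a homomorphism `f : R → A`, satisfies the analogue of property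
**P** in which only the differentials of elements of `R` occur. -/
structure SatisfiesRelP {k R A U : Type*} [CommRing k] [CommRing R] [Algebra k R] [CommRing A]
    [Algebra k A] [Ring U] [Algebra k U] (πR : PoissonBracket k R) (πA : PoissonBracket k A)
    (f : R →ₐ[k] A) (γ : A →ₐ[k] U) (δ : R →ₗ[k] U) : Prop where
  lie : ∀ a b, δ (πR.br a b) = δ a * δ b - δ b * δ a
  bracket : ∀ a p, γ (πA.br (f a) p) = δ a * γ p - γ p * δ a
  mul : ∀ a b, δ (a * b) = γ (f a) * δ b + γ (f b) * δ a

/-- Defining relations of the relative Poisson enveloping algebra of `f : R → A`. -/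
inductive RelPoissonEnvRel {k R A : Type*} [CommRing k] [CommRing R] [Algebra k R] [CommRing A]
    [Algebra k A] (πR : PoissonBracket k R) (πA : PoissonBracket k A) (f : R →ₐ[k] A) :
    FreeAlgebra k (A ⊕ R) → FreeAlgebra k (A ⊕ R) → Prop
  | i_algebraMap (c : k) : RelPoissonEnvRel πR πA f
      (FreeAlgebra.ι k (Sum.inl (algebraMap k A c))) (algebraMap k (FreeAlgebra k (A ⊕ R)) c)
  | i_add (a b : A) : RelPoissonEnvRel πR πA f (FreeAlgebra.ι k (Sum.inl (a + b)))
      (FreeAlgebra.ι k (Sum.inl a) + FreeAlgebra.ι k (Sum.inl b))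
  | i_mul (a b : A) : RelPoissonEnvRel πR πA f (FreeAlgebra.ι k (Sum.inl (a * b)))
      (FreeAlgebra.ι k (Sum.inl a) * FreeAlgebra.ι k (Sum.inl b))
  | d_add (a b : R) : RelPoissonEnvRel πR πA f (FreeAlgebra.ι k (Sum.inr (a + b)))
      (FreeAlgebra.ι k (Sum.inr a) + FreeAlgebra.ι k (Sum.inr b))
  | d_smul (c : k) (a : R) : RelPoissonEnvRel πR πA f (FreeAlgebra.ι k (Sum.inr (c • a)))
      (c • FreeAlgebra.ι k (Sum.inr a))
  | lie (a b : R) : RelPoissonEnvRel πR πA f (FreeAlgebra.ι k (Sum.inr (πR.br a b)))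
      (FreeAlgebra.ι k (Sum.inr a) * FreeAlgebra.ι k (Sum.inr b)
        - FreeAlgebra.ι k (Sum.inr b) * FreeAlgebra.ι k (Sum.inr a))
  | bracket (a : R) (p : A) : RelPoissonEnvRel πR πA f
      (FreeAlgebra.ι k (Sum.inl (πA.br (f a) p)))
      (FreeAlgebra.ι k (Sum.inr a) * FreeAlgebra.ι k (Sum.inl p)
        - FreeAlgebra.ι k (Sum.inl p) * FreeAlgebra.ι k (Sum.inr a))
  | d_mul (a b : R) : RelPoissonEnvRel πR πA f (FreeAlgebra.ι k (Sum.inr (a * b)))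
      (FreeAlgebra.ι k (Sum.inl (f a)) * FreeAlgebra.ι k (Sum.inr b)
        + FreeAlgebra.ι k (Sum.inl (f b)) * FreeAlgebra.ι k (Sum.inr a))

/-- The relative Poisson enveloping algebra of a homomorphism `f : R → A` of Poisson algebras: it
is generated by `A` and the differentials of the elements of `R`. -/
def RelPoissonEnv {k R A : Type*} [CommRing k] [CommRing R] [Algebra k R] [CommRing A]
    [Algebra k A] (πR : PoissonBracket k R) (πA : PoissonBracket k A) (f : R →ₐ[k] A) : Type _ :=
  RingQuot (RelPoissonEnvRel πR πA f)

namespace RelPoissonEnv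

variable {k R A : Type*} [CommRing k] [CommRing R] [Algebra k R] [CommRing A] [Algebra k A]
  (πR : PoissonBracket k R) (πA : PoissonBracket k A) (f : R →ₐ[k] A)

noncomputable instance : Ring (RelPoissonEnv πR πA f) :=
  inferInstanceAs (Ring (RingQuot (RelPoissonEnvRel πR πA f)))

noncomputable instance : Algebra k (RelPoissonEnv πR πA f) :=
  inferInstanceAs (Algebra k (RingQuot (RelPoissonEnvRel πR πA f)))

/-- The quotient map from the free algebra. -/
noncomputable def mk : FreeAlgebra k (A ⊕ R) →ₐ[k] RelPoissonEnv πR πA f :=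
  RingQuot.mkAlgHom k (RelPoissonEnvRel πR πA f)

theorem mk_surjective : Function.Surjective (mk πR πA f) :=
  RingQuot.mkAlgHom_surjective k _

variable {πR πA f} in
theorem mk_rel {x y : FreeAlgebra k (A ⊕ R)} (h : RelPoissonEnvRel πR πA f x y) :
    mk πR πA f x = mk πR πA f y :=
  RingQuot.mkAlgHom_rel k h

/-- The canonical algebra homomorphism from `A`. -/
noncomputable def i : A →ₐ[k] RelPoissonEnv πR πA f :=
  AlgHom.ofLinearMap
    { toFun := fun a => mk πR πA f (FreeAlgebra.ι k (Sum.inl a))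
      map_add' := fun a b => by
        rw [mk_rel (RelPoissonEnvRel.i_add a b), map_add]
      map_smul' := fun c a => by
        rw [Algebra.smul_def c a, mk_rel (RelPoissonEnvRel.i_mul _ a), map_mul,
          mk_rel (RelPoissonEnvRel.i_algebraMap c), AlgHom.commutes,
          RingHom.id_apply, Algebra.smul_def] }
    (by
      have h := mk_rel (RelPoissonEnvRel.i_algebraMap (πR := πR) (πA := πA) (f := f) (1 : k))
      rw [map_one, map_one, map_one] at h
      exact h)
    (fun a b => by
      have h := mk_rel (RelPoissonEnvRel.i_mul (πR := πR) (πA := πA) (f := f) a b)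
      rw [map_mul] at h
      exact h)

/-- The canonical map `d` from `R`. -/
noncomputable def d : R →ₗ[k] RelPoissonEnv πR πA f where
  toFun a := mk πR πA f (FreeAlgebra.ι k (Sum.inr a))
  map_add' a b := by rw [mk_rel (RelPoissonEnvRel.d_add a b), map_add]
  map_smul' c a := by
    rw [mk_rel (RelPoissonEnvRel.d_smul c a), map_smul, RingHom.id_apply]

theorem satisfiesRelP : SatisfiesRelP πR πA f (i πR πA f) (d πR πA f) where
  lie a b := by
    have h := mk_rel (RelPoissonEnvRel.lie (πR := πR) (πA := πA) (f := f) a b)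
    rw [map_sub, map_mul, map_mul] at h
    exact h
  bracket a b := by
    have h := mk_rel (RelPoissonEnvRel.bracket (πR := πR) (πA := πA) (f := f) a b)
    rw [map_sub, map_mul, map_mul] at h
    exact h
  mul a b := by
    have h := mk_rel (RelPoissonEnvRel.d_mul (πR := πR) (πA := πA) (f := f) a b)
    rw [map_add, map_mul, map_mul] at h
    exact h

/-- An induction principle: the relative enveloping algebra is generated by `A` and `dR`. -/
theorem induction {P : RelPoissonEnv πR πA f → Prop} (hi : ∀ a, P (i πR πA f a))
    (hd : ∀ a, P (d πR πA f a)) (hadd : ∀ u v, P u → P v → P (u + v))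
    (hmul : ∀ u v, P u → P v → P (u * v)) (u : RelPoissonEnv πR πA f) : P u := by
  obtain ⟨z, rfl⟩ := mk_surjective πR πA f u
  induction z using FreeAlgebra.induction with
  | grade0 c =>
    rw [AlgHom.commutes, ← (i πR πA f).commutes]
    exact hi _
  | grade1 x =>
    rcases x with a | a
    · exact hi a
    · exact hd a
  | mul x y hx hy => rw [map_mul]; exact hmul _ _ hx hy
  | add x y hx hy => rw [map_add]; exact hadd _ _ hx hy

section lift

variable {πR πA f} {U : Type*} [Ring U] [Algebra k U] (γ : A →ₐ[k] U) (δ : R →ₗ[k] U)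
  (h : SatisfiesRelP πR πA f γ δ)

/-- The universal property of the relative enveloping algebra. -/
noncomputable def lift : RelPoissonEnv πR πA f →ₐ[k] U :=
  RingQuot.liftAlgHom k ⟨FreeAlgebra.lift k (Sum.elim γ δ), fun x y hxy => by
    induction hxy with
    | i_algebraMap c => simp
    | i_add a b => simp
    | i_mul a b => simp
    | d_add a b => simp
    | d_smul c a => simp
    | lie a b => simp [h.lie]
    | bracket a b => simp [h.bracket]
    | d_mul a b => simp [h.mul]⟩

theorem lift_mk (z : FreeAlgebra k (A ⊕ R)) :
    lift γ δ h (mk πR πA f z) = FreeAlgebra.lift k (Sum.elim γ δ) z :=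
  RingQuot.liftAlgHom_mkAlgHom_apply k _ _ _

@[simp] theorem lift_i (a : A) : lift γ δ h (i πR πA f a) = γ a := by
  change lift γ δ h (mk πR πA f (FreeAlgebra.ι k (Sum.inl a))) = γ a
  simp [lift_mk]

@[simp] theorem lift_d (a : R) : lift γ δ h (d πR πA f a) = δ a := by
  change lift γ δ h (mk πR πA f (FreeAlgebra.ι k (Sum.inr a))) = δ a
  simp [lift_mk]

end lift

variable {πR πA f}

theorem satisfiesP_comp (hf : ∀ a b, f (πR.br a b) = πA.br (f a) (f b)) :
    SatisfiesP πR ((i πR πA f).comp f) (d πR πA f) where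
  lie a b := (satisfiesRelP πR πA f).lie a b
  bracket a b := by simp [hf, (satisfiesRelP πR πA f).bracket]
  mul a b := by simp [(satisfiesRelP πR πA f).mul]

/-- The canonical homomorphism from `R^e` to the relative enveloping algebra. -/
noncomputable def ofEnv (hf : ∀ a b, f (πR.br a b) = πA.br (f a) (f b)) :
    PoissonEnv πR →ₐ[k] RelPoissonEnv πR πA f :=
  PoissonEnv.lift ((i πR πA f).comp f) (d πR πA f) (satisfiesP_comp hf)

theorem satisfiesRelP_comp (hf : ∀ a b, f (πR.br a b) = πA.br (f a) (f b)) :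
    SatisfiesRelP πR πA f (PoissonEnv.i πA) ((PoissonEnv.d πA).comp f.toLinearMap) where
  lie a b := by simp [hf, (PoissonEnv.satisfiesP πA).lie]
  bracket a b := by simp [(PoissonEnv.satisfiesP πA).bracket]
  mul a b := by simp [(PoissonEnv.satisfiesP πA).mul]

/-- The canonical homomorphism from the relative enveloping algebra to `A^e`. -/
noncomputable def toEnv (hf : ∀ a b, f (πR.br a b) = πA.br (f a) (f b)) :
    RelPoissonEnv πR πA f →ₐ[k] PoissonEnv πA :=
  lift (PoissonEnv.i πA) ((PoissonEnv.d πA).comp f.toLinearMap) (satisfiesRelP_comp hf)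

end RelPoissonEnv

/-! ### Generators of the enveloping algebra, and its opposite -/

namespace PoissonEnv

variable {k R : Type*} [CommRing k] [CommRing R] [Algebra k R]

attribute [simp] lift_i lift_d

theorem mk_surjective (π : PoissonBracket k R) : Function.Surjective (mk π) :=
  RingQuot.mkAlgHom_surjective k _

/-- An induction principle: `R^e` is generated by `R` and `dR`. -/
theorem induction {π : PoissonBracket k R} {P : PoissonEnv π → Prop} (hi : ∀ a, P (i π a))
    (hd : ∀ a, P (d π a)) (hadd : ∀ u v, P u → P v → P (u + v))
    (hmul : ∀ u v, P u → P v → P (u * v)) (u : PoissonEnv π) : P u := by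
  obtain ⟨z, rfl⟩ := mk_surjective π u
  induction z using FreeAlgebra.induction with
  | grade0 c =>
    rw [AlgHom.commutes, ← (i π).commutes]
    exact hi _
  | grade1 x =>
    rcases x with a | a
    · exact hi a
    · exact hd a
  | mul x y hx hy => rw [map_mul]; exact hmul _ _ hx hy
  | add x y hx hy => rw [map_add]; exact hadd _ _ hx hy

theorem algHom_ext {π : PoissonBracket k R} {U : Type*} [Ring U] [Algebra k U]
    {φ ψ : PoissonEnv π →ₐ[k] U} (hi : ∀ a, φ (i π a) = ψ (i π a))
    (hd : ∀ a, φ (d π a) = ψ (d π a)) : φ = ψ := by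
  ext u
  induction u using induction with
  | hi a => exact hi a
  | hd a => exact hd a
  | hadd u v hu hv => rw [map_add, map_add, hu, hv]
  | hmul u v hu hv => rw [map_mul, map_mul, hu, hv]

/-- A pair with property **P** for `π` gives one for `-π`, with values in the opposite algebra. -/
theorem _root_.SatisfiesP.op {π : PoissonBracket k R} {U : Type*} [Ring U] [Algebra k U]
    {γ : R →ₐ[k] U} {δ : R →ₗ[k] U} (h : SatisfiesP π γ δ) {π' : PoissonBracket k R}
    (hπ : ∀ a b, π'.br a b = -π.br a b) :
    SatisfiesP π' (γ.toOpposite fun a b => by rw [Commute, SemiconjBy, ← map_mul, mul_comm, map_mul])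
      ((MulOpposite.opLinearEquiv k).toLinearMap.comp δ) where
  lie a b := by
    apply MulOpposite.unop_injective
    simp [hπ, h.lie]
  bracket a b := by
    apply MulOpposite.unop_injective
    simp [hπ, h.bracket]
  mul a b := by
    apply MulOpposite.unop_injective
    -- Only the order of the factors in the product rule is at stake: `[δa, γb] + [δb, γa]` is the
    -- image of `{a, b} + {b, a} = 0`.
    have h1 := h.bracket a b
    have h2 := h.bracket b a
    rw [π.br_skew, map_neg] at h2
    simp only [LinearMap.comp_apply, h.mul]
    simp
    have h3 := h2.symm.trans (congrArg Neg.neg h1)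
    rw [sub_eq_iff_eq_add] at h3
    rw [h3]
    abel

/-- The homomorphism from the enveloping algebra of `-π` to the opposite of that of `π`. -/
noncomputable def toOp (π π' : PoissonBracket k R) (hπ : ∀ a b, π'.br a b = -π.br a b) :
    PoissonEnv π' →ₐ[k] (PoissonEnv π)ᵐᵒᵖ :=
  lift _ _ ((satisfiesP π).op hπ)

theorem toOp_i (π π' : PoissonBracket k R) (hπ : ∀ a b, π'.br a b = -π.br a b) (a : R) :
    toOp π π' hπ (i π' a) = MulOpposite.op (i π a) := by
  simp [toOp]

theorem toOp_d (π π' : PoissonBracket k R) (hπ : ∀ a b, π'.br a b = -π.br a b) (a : R) :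
    toOp π π' hπ (d π' a) = MulOpposite.op (d π a) := by
  simp [toOp]

/-- The opposite of the enveloping algebra of `-π` is the enveloping algebra of `π`. -/
noncomputable def opEquiv (π : PoissonBracket k R) : (PoissonEnv π.neg)ᵐᵒᵖ ≃ₐ[k] PoissonEnv π :=
  have h : ∀ a b, π.br a b = -π.neg.br a b := fun a b => by simp
  AlgEquiv.ofAlgHom
    ((AlgEquiv.opOp k (PoissonEnv π)).symm.toAlgHom.comp
      (AlgHom.op (toOp π π.neg π.neg_br)))
    (toOp π.neg π h)
    (algHom_ext
      (fun a => by
        have h1 := toOp_i π.neg π h a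
        have h2 := toOp_i π π.neg π.neg_br a
        simp only [AlgHom.comp_apply, h1]
        exact congrArg MulOpposite.unop h2)
      (fun a => by
        have h1 := toOp_d π.neg π h a
        have h2 := toOp_d π π.neg π.neg_br a
        simp only [AlgHom.comp_apply, h1]
        exact congrArg MulOpposite.unop h2))
    (by
      ext u
      induction u using MulOpposite.rec' with
      | h u =>
      apply MulOpposite.unop_injective
      change (toOp π.neg π h (toOp π π.neg π.neg_br u).unop).unop = u
      induction u using induction with
      | hi a =>
        rw [toOp_i π π.neg]
        exact congrArg MulOpposite.unop (toOp_i π.neg π h a)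
      | hd a =>
        rw [toOp_d π π.neg]
        exact congrArg MulOpposite.unop (toOp_d π.neg π h a)
      | hadd u v hu hv => simp only [map_add, MulOpposite.unop_add, hu, hv]
      | hmul u v hu hv => simp only [map_mul, MulOpposite.unop_mul, hu, hv])

theorem opEquiv_i (π : PoissonBracket k R) (a : R) :
    opEquiv π (MulOpposite.op (i π.neg a)) = i π a :=
  congrArg MulOpposite.unop (toOp_i π π.neg π.neg_br a)

theorem opEquiv_d (π : PoissonBracket k R) (a : R) :
    opEquiv π (MulOpposite.op (d π.neg a)) = d π a :=
  congrArg MulOpposite.unop (toOp_d π π.neg π.neg_br a)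

end PoissonEnv

/-! ### Double extensions: transport, opposites, uniqueness of coefficients, normal forms -/

section DoubleExtensionGeneral

variable {F S T S' T' : Type*} [CommRing F] [Ring S] [Algebra F S] [Ring T] [Algebra F T]
  [Ring S'] [Algebra F S'] [Ring T'] [Algebra F T']

/-- `g` need not be bijective here: besides transport along isomorphisms, this serves to compute the
image of an embedding into `A^e` as `B`. -/
theorem image_range_union_pair (j : S →ₐ[F] T) (y : Fin 2 → T) (j' : S' →ₐ[F] T') (y' : Fin 2 → T')
    (eS : S ≃ₐ[F] S') (g : T →ₐ[F] T') (hj : ∀ s, j' (eS s) = g (j s))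
    (hy : ∀ r, y' r = g (y r)) :
    g '' (Set.range j ∪ {y 0, y 1}) = Set.range j' ∪ {y' 0, y' 1} := by
  rw [Set.image_union, Set.image_pair, hy, hy, ← Set.range_comp]
  congr 1
  ext t
  constructor
  · rintro ⟨s, rfl⟩
    exact ⟨eS s, hj s⟩
  · rintro ⟨s, rfl⟩
    exact ⟨eS.symm s, by simp [← hj]⟩

theorem adjoin_eq_top_transport {j : S →ₐ[F] T} {y : Fin 2 → T} {j' : S' →ₐ[F] T'}
    {y' : Fin 2 → T'} (eS : S ≃ₐ[F] S') (eT : T ≃ₐ[F] T') (hj : ∀ s, j' (eS s) = eT (j s))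
    (hy : ∀ r, y' r = eT (y r)) (h : Algebra.adjoin F (Set.range j ∪ {y 0, y 1}) = ⊤) :
    Algebra.adjoin F (Set.range j' ∪ {y' 0, y' 1}) = ⊤ := by
  rw [← image_range_union_pair j y j' y' eS (eT : T →ₐ[F] T') hj hy, ← AlgHom.map_adjoin, h,
    Algebra.map_top, AlgHom.range_eq_top]
  exact eT.surjective

theorem injective_transport {j : S →ₐ[F] T} {j' : S' →ₐ[F] T'} (eS : S ≃ₐ[F] S')
    (eT : T ≃ₐ[F] T') (hj : ∀ s, j' (eS s) = eT (j s)) (h : Function.Injective j) :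
    Function.Injective j' := by
  have : (j' : S' → T') = eT ∘ j ∘ eS.symm := by
    funext s
    simp [← hj]
  rw [this]
  exact eT.injective.comp (h.comp eS.symm.injective)

theorem IsLeftDoubleExtension.transport {j : S →ₐ[F] T} {y : Fin 2 → T} {j' : S' →ₐ[F] T'}
    {y' : Fin 2 → T'} (h : IsLeftDoubleExtension j y) (eS : S ≃ₐ[F] S') (eT : T ≃ₐ[F] T')
    (hj : ∀ s, j' (eS s) = eT (j s)) (hy : ∀ r, y' r = eT (y r)) :
    IsLeftDoubleExtension j' y' where
  injective := injective_transport eS eT hj h.injective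
  generates := adjoin_eq_top_transport eS eT hj hy h.generates
  relation := by
    obtain ⟨p, p', a, b, c, H⟩ := h.relation
    refine ⟨p, p', eS a, eS b, eS c, ?_⟩
    simp only [hj, hy, ← map_mul, ← map_pow, ← map_smul, ← map_add, H]
  basis := by
    have : (fun c : ℕ × ℕ →₀ S' => c.sum fun p s => j' s * (y' 0 ^ p.1 * y' 1 ^ p.2)) =
        eT ∘ (fun c : ℕ × ℕ →₀ S => c.sum fun p s => j s * (y 0 ^ p.1 * y 1 ^ p.2)) ∘
          (Finsupp.mapRange.addEquiv eS.symm.toAddEquiv) := by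
      funext c
      simp only [Function.comp_apply]
      rw [Finsupp.mapRange.addEquiv_apply, Finsupp.sum_mapRange_index (by simp), Finsupp.sum,
        Finsupp.sum, map_sum]
      refine Finset.sum_congr rfl fun p _ => ?_
      have := hj (eS.symm (c p))
      rw [AlgEquiv.apply_symm_apply] at this
      simp [this, hy]
    rw [this]
    exact eT.bijective.comp (h.basis.comp (AddEquiv.bijective _))
  subset a b c := by
    obtain ⟨a', b', c', H⟩ := h.subset (eS.symm a) (eS.symm b) (eS.symm c)
    refine ⟨eS a', eS b', eS c', ?_⟩
    have := congrArg eT H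
    simpa only [map_add, map_mul, ← hj, ← hy, AlgEquiv.apply_symm_apply] using this

theorem IsRightDoubleExtension.transport {j : S →ₐ[F] T} {y : Fin 2 → T} {j' : S' →ₐ[F] T'}
    {y' : Fin 2 → T'} (h : IsRightDoubleExtension j y) (eS : S ≃ₐ[F] S') (eT : T ≃ₐ[F] T')
    (hj : ∀ s, j' (eS s) = eT (j s)) (hy : ∀ r, y' r = eT (y r)) :
    IsRightDoubleExtension j' y' where
  injective := injective_transport eS eT hj h.injective
  generates := adjoin_eq_top_transport eS eT hj hy h.generates
  relation := by
    obtain ⟨p, p', a, b, c, H⟩ := h.relation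
    refine ⟨p, p', eS a, eS b, eS c, ?_⟩
    simp only [hj, hy, ← map_mul, ← map_pow, ← map_smul, ← map_add, H]
  basis := by
    have : (fun c : ℕ × ℕ →₀ S' => c.sum fun p s => (y' 1 ^ p.1 * y' 0 ^ p.2) * j' s) =
        eT ∘ (fun c : ℕ × ℕ →₀ S => c.sum fun p s => (y 1 ^ p.1 * y 0 ^ p.2) * j s) ∘
          (Finsupp.mapRange.addEquiv eS.symm.toAddEquiv) := by
      funext c
      simp only [Function.comp_apply]
      rw [Finsupp.mapRange.addEquiv_apply, Finsupp.sum_mapRange_index (by simp), Finsupp.sum,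
        Finsupp.sum, map_sum]
      refine Finset.sum_congr rfl fun p _ => ?_
      have := hj (eS.symm (c p))
      rw [AlgEquiv.apply_symm_apply] at this
      simp [this, hy]
    rw [this]
    exact eT.bijective.comp (h.basis.comp (AddEquiv.bijective _))
  subset a b c := by
    obtain ⟨a', b', c', H⟩ := h.subset (eS.symm a) (eS.symm b) (eS.symm c)
    refine ⟨eS a', eS b', eS c', ?_⟩
    have := congrArg eT H
    simpa only [map_add, map_mul, ← hj, ← hy, AlgEquiv.apply_symm_apply] using this

theorem adjoin_op_eq_top {j : S →ₐ[F] T} {y : Fin 2 → T}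
    (h : Algebra.adjoin F (Set.range j ∪ {y 0, y 1}) = ⊤) :
    Algebra.adjoin F (Set.range (AlgHom.op j) ∪ {MulOpposite.op (y 0), MulOpposite.op (y 1)}) =
      ⊤ := by
  have h1 := congrArg Subalgebra.op h
  rw [Subalgebra.op_adjoin] at h1
  rw [← Subalgebra.op_top, ← h1]
  congr 1
  ext t
  simp only [Set.mem_union, Set.mem_range, Set.mem_insert_iff, Set.mem_singleton_iff,
    Set.mem_preimage]
  refine or_congr ⟨?_, ?_⟩ (or_congr ?_ ?_)
  · rintro ⟨s, rfl⟩
    exact ⟨s.unop, rfl⟩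
  · rintro ⟨s, hs⟩
    exact ⟨MulOpposite.op s, MulOpposite.unop_injective hs⟩
  · exact ⟨fun h => by rw [h]; rfl, fun h => MulOpposite.unop_injective h⟩
  · exact ⟨fun h => by rw [h]; rfl, fun h => MulOpposite.unop_injective h⟩

theorem injective_op {j : S →ₐ[F] T} (h : Function.Injective j) :
    Function.Injective (AlgHom.op j) :=
  MulOpposite.op_injective.comp (h.comp MulOpposite.unop_injective)

/-- Finitely supported functions on pairs with values in the opposite ring, with the two indices
interchanged. -/
noncomputable def finsuppSwapOp (S : Type*) [Ring S] : (ℕ × ℕ →₀ Sᵐᵒᵖ) ≃ (ℕ × ℕ →₀ S) :=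
  (Finsupp.mapRange.addEquiv (MulOpposite.opAddEquiv (α := S)).symm).toEquiv.trans
    (Finsupp.domCongr (M := S) (Equiv.prodComm ℕ ℕ)).toEquiv

theorem sum_finsuppSwapOp (c : ℕ × ℕ →₀ Sᵐᵒᵖ) (φ : ℕ × ℕ → S → T) (hφ : ∀ p, φ p 0 = 0) :
    (finsuppSwapOp S c).sum φ = c.sum fun p s => φ p.swap s.unop := by
  simp only [finsuppSwapOp, Equiv.trans_apply, AddEquiv.toEquiv_eq_coe, AddEquiv.coe_toEquiv,
    Finsupp.domCongr_apply, Finsupp.mapRange.addEquiv_apply]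
  rw [Finsupp.sum_equivMapDomain, Finsupp.sum_mapRange_index (fun p => hφ _)]
  rfl

/-- Reversing products turns `y₂ ^ m * y₁ ^ n * s` into `s * y₁ ^ n * y₂ ^ m`; the exponents change
places, whence the index swap in `finsuppSwapOp`. -/
theorem IsRightDoubleExtension.op {j : S →ₐ[F] T} {y : Fin 2 → T}
    (h : IsRightDoubleExtension j y) :
    IsLeftDoubleExtension (AlgHom.op j) (fun r => MulOpposite.op (y r)) where
  injective := injective_op h.injective
  generates := adjoin_op_eq_top h.generates
  relation := by
    obtain ⟨p, p', a, b, c, H⟩ := h.relation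
    exact ⟨p, p', .op a, .op b, .op c, MulOpposite.unop_injective (by simpa using H)⟩
  basis := by
    have : (fun c : ℕ × ℕ →₀ Sᵐᵒᵖ => c.sum fun p s => AlgHom.op j s *
          (MulOpposite.op (y 0) ^ p.1 * MulOpposite.op (y 1) ^ p.2)) =
        MulOpposite.op ∘ (fun c : ℕ × ℕ →₀ S => c.sum fun p s => (y 1 ^ p.1 * y 0 ^ p.2) * j s) ∘
          (finsuppSwapOp S) := by
      funext c
      simp only [Function.comp_apply]
      rw [sum_finsuppSwapOp _ _ (by simp), Finsupp.sum, Finsupp.sum]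
      refine Eq.trans ?_ (map_sum MulOpposite.opAddEquiv _ _).symm
      exact Finset.sum_congr rfl fun p _ => MulOpposite.unop_injective (by simp)
    rw [this]
    exact MulOpposite.opEquiv.bijective.comp (h.basis.comp (Equiv.bijective _))
  subset a b c := by
    obtain ⟨a', b', c', H⟩ := h.subset a.unop b.unop c.unop
    exact ⟨.op a', .op b', .op c', MulOpposite.unop_injective (by simpa using H)⟩

theorem IsLeftDoubleExtension.op {j : S →ₐ[F] T} {y : Fin 2 → T}
    (h : IsLeftDoubleExtension j y) :
    IsRightDoubleExtension (AlgHom.op j) (fun r => MulOpposite.op (y r)) where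
  injective := injective_op h.injective
  generates := adjoin_op_eq_top h.generates
  relation := by
    obtain ⟨p, p', a, b, c, H⟩ := h.relation
    exact ⟨p, p', .op a, .op b, .op c, MulOpposite.unop_injective (by simpa using H)⟩
  basis := by
    have : (fun c : ℕ × ℕ →₀ Sᵐᵒᵖ => c.sum fun p s =>
          (MulOpposite.op (y 1) ^ p.1 * MulOpposite.op (y 0) ^ p.2) * AlgHom.op j s) =
        MulOpposite.op ∘ (fun c : ℕ × ℕ →₀ S => c.sum fun p s => j s * (y 0 ^ p.1 * y 1 ^ p.2)) ∘
          (finsuppSwapOp S) := by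
      funext c
      simp only [Function.comp_apply]
      rw [sum_finsuppSwapOp _ _ (by simp), Finsupp.sum, Finsupp.sum]
      refine Eq.trans ?_ (map_sum MulOpposite.opAddEquiv _ _).symm
      exact Finset.sum_congr rfl fun p _ => MulOpposite.unop_injective (by simp)
    rw [this]
    exact MulOpposite.opEquiv.bijective.comp (h.basis.comp (Equiv.bijective _))
  subset a b c := by
    obtain ⟨a', b', c', H⟩ := h.subset a.unop b.unop c.unop
    exact ⟨.op a', .op b', .op c', MulOpposite.unop_injective (by simpa using H)⟩

/-- In a left double extension the coefficients of a linear expression are unique. -/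
theorem IsLeftDoubleExtension.coeff_unique {j : S →ₐ[F] T} {y : Fin 2 → T}
    (h : IsLeftDoubleExtension j y) {a b c a' b' c' : S}
    (H : j a * y 0 + j b * y 1 + j c = j a' * y 0 + j b' * y 1 + j c') :
    a = a' ∧ b = b' ∧ c = c' := by
  have key : ∀ a b c : S, ((Finsupp.single (1, 0) a + Finsupp.single (0, 1) b +
      Finsupp.single (0, 0) c : ℕ × ℕ →₀ S).sum fun p s => j s * (y 0 ^ p.1 * y 1 ^ p.2)) =
      j a * y 0 + j b * y 1 + j c := by
    intro a b c
    rw [Finsupp.sum_add_index' (by simp) (by simp [add_mul]),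
      Finsupp.sum_add_index' (by simp) (by simp [add_mul])]
    simp
  have H' := h.basis.injective ((key a b c).trans (H.trans (key a' b' c').symm))
  refine ⟨?_, ?_, ?_⟩
  · simpa using DFunLike.congr_fun H' (1, 0)
  · simpa using DFunLike.congr_fun H' (0, 1)
  · simpa using DFunLike.congr_fun H' (0, 0)

/-- A left double extension has maps `σ`, `δ` as in the definition of DE-data, and their values
are determined by the commutation relations. -/
theorem IsLeftDoubleExtension.exists_crossing {j : S →ₐ[F] T} {y : Fin 2 → T}
    (h : IsLeftDoubleExtension j y) :
    ∃ (σ : S →ₗ[F] Matrix (Fin 2) (Fin 2) S) (δ : S →ₗ[F] (Fin 2 → S)),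
      (∀ (a : S) (r : Fin 2),
        y r * j a = j (σ a r 0) * y 0 + j (σ a r 1) * y 1 + j (δ a r)) ∧
      ∀ (a : S) (c c' : Fin 2 → S) (e : Fin 2 → S),
        (∀ r, y r * j a = j (c r) * y 0 + j (c' r) * y 1 + j (e r)) →
        σ a = !![c 0, c' 0; c 1, c' 1] ∧ δ a = ![e 0, e 1] := by
  have ex : ∀ (a : S) (r : Fin 2), ∃ u v w : S,
      y r * j a = j u * y 0 + j v * y 1 + j w := by
    intro a r
    fin_cases r
    · simpa using h.subset a 0 0
    · simpa using h.subset 0 a 0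
  choose u v w H using ex
  -- The coefficients were chosen arbitrarily; their uniqueness forces linearity.
  have hadd : ∀ a b r, u (a + b) r = u a r + u b r ∧ v (a + b) r = v a r + v b r ∧
      w (a + b) r = w a r + w b r := by
    intro a b r
    apply h.coeff_unique
    rw [← H, map_add, mul_add, H, H]
    simp only [map_add, add_mul]
    abel
  have hsmul : ∀ (t : F) a r, u (t • a) r = t • u a r ∧ v (t • a) r = t • v a r ∧
      w (t • a) r = t • w a r := by
    intro t a r
    apply h.coeff_unique
    rw [← H, map_smul, mul_smul_comm, H]
    simp only [map_smul, smul_mul_assoc, smul_add]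
  refine ⟨⟨⟨fun a => Matrix.of fun r => ![u a r, v a r], fun a b => ?_⟩, fun t a => ?_⟩,
    ⟨⟨w, fun a b => ?_⟩, fun t a => ?_⟩, fun a r => ?_, fun a c c' e hc => ⟨?_, ?_⟩⟩
  · ext r l
    fin_cases l
    · simpa using (hadd a b r).1
    · simpa using (hadd a b r).2.1
  · ext r l
    fin_cases l
    · simpa using (hsmul t a r).1
    · simpa using (hsmul t a r).2.1
  · ext r
    exact (hadd a b r).2.2
  · ext r
    exact (hsmul t a r).2.2
  · exact H a r
  · have h0 := h.coeff_unique ((H a 0).symm.trans (hc 0))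
    have h1 := h.coeff_unique ((H a 1).symm.trans (hc 1))
    ext r l
    fin_cases r <;> fin_cases l <;> simp [h0.1, h0.2.1, h1.1, h1.2.1]
  · have h0 := h.coeff_unique ((H a 0).symm.trans (hc 0))
    have h1 := h.coeff_unique ((H a 1).symm.trans (hc 1))
    ext r
    fin_cases r
    · exact h0.2.2
    · exact h1.2.2

/-- If `y₁`, `y₂` move past the elements of `S`, and past each other with leading coefficient `1`,
then the ordered monomials span the extension. -/
theorem exists_left_sum {j : S →ₐ[F] T} {y : Fin 2 → T}
    (hgen : Algebra.adjoin F (Set.range j ∪ {y 0, y 1}) = ⊤)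
    (hcross : ∀ (r : Fin 2) (s : S), ∃ a b c : S, y r * j s = j a * y 0 + j b * y 1 + j c)
    {τ₁ τ₂ τ₀ : S} (hrel : y 1 * y 0 = y 0 * y 1 + j τ₁ * y 0 + j τ₂ * y 1 + j τ₀) (t : T) :
    ∃ c : ℕ × ℕ →₀ S, (c.sum fun p s => j s * (y 0 ^ p.1 * y 1 ^ p.2)) = t := by
  -- The filtration bounds the exponent of `y₁` only; the exponent of `y₂` is free, since `y₂`
  -- itself occurs when coefficients are crossed.
  let W : ℕ → AddSubgroup T := fun m => AddSubgroup.closure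
    {t | ∃ (s : S) (m' n : ℕ), m' ≤ m ∧ t = j s * (y 0 ^ m' * y 1 ^ n)}
  have hW : ∀ {m m' n : ℕ} (s : S), m' ≤ m → j s * (y 0 ^ m' * y 1 ^ n) ∈ W m :=
    fun s h => AddSubgroup.subset_closure ⟨s, _, _, h, rfl⟩
  have hmono : ∀ {m m' : ℕ}, m ≤ m' → W m ≤ W m' := by
    intro m m' h
    refine AddSubgroup.closure_mono ?_
    rintro _ ⟨s, l, n, hl, rfl⟩
    exact ⟨s, l, n, hl.trans h, rfl⟩
  have hS : ∀ (m : ℕ) (s : S) (t : T), t ∈ W m → j s * t ∈ W m := by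
    intro m s t ht
    induction ht using AddSubgroup.closure_induction with
    | mem _ h =>
      obtain ⟨a, l, n, hl, rfl⟩ := h
      rw [← mul_assoc, ← map_mul]
      exact hW _ hl
    | zero => simp
    | add _ _ _ _ h1 h2 => rw [mul_add]; exact add_mem h1 h2
    | neg _ _ h1 => rw [mul_neg]; exact neg_mem h1
  -- Once `y₂` times a bare monomial is controlled, left coefficients cost only one crossing.
  have hstep : ∀ m m' : ℕ, m ≤ m' → (∀ l ≤ m, ∀ n, y 1 * (y 0 ^ l * y 1 ^ n) ∈ W m') →
      ∀ t ∈ W m, y 0 * t ∈ W (m' + 1) ∧ y 1 * t ∈ W (m' + 1) := by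
    intro m m' hm H t ht
    induction ht using AddSubgroup.closure_induction with
    | mem _ h =>
      obtain ⟨s, l, n, hl, rfl⟩ := h
      have hr : ∀ r, y r * (j s * (y 0 ^ l * y 1 ^ n)) ∈ W (m' + 1) := by
        intro r
        obtain ⟨a, b, c, h⟩ := hcross r s
        have e : y r * (j s * (y 0 ^ l * y 1 ^ n)) = j a * (y 0 ^ (l + 1) * y 1 ^ n) +
            j b * (y 1 * (y 0 ^ l * y 1 ^ n)) + j c * (y 0 ^ l * y 1 ^ n) := by
          rw [← mul_assoc, h, pow_succ']
          simp only [add_mul, mul_assoc]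
        rw [e]
        exact add_mem (add_mem (hW _ (by omega))
          (hS _ _ _ (hmono (Nat.le_succ _) (H l hl n)))) (hW _ (by omega))
      exact ⟨hr 0, hr 1⟩
    | zero => simp
    | add _ _ _ _ h1 h2 =>
      rw [mul_add, mul_add]; exact ⟨add_mem h1.1 h2.1, add_mem h1.2 h2.2⟩
    | neg _ _ h1 => rw [mul_neg, mul_neg]; exact ⟨neg_mem h1.1, neg_mem h1.2⟩
  -- Multiplication by `y₂` does not raise the `y₁`-degree of a monomial: in `y₂ y₁ ^ (m + 1)` one
  -- exchange leaves `y₁ (y₂ y₁ ^ m)`, where the inner factor stays in degree `m`, plus terms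
  -- already controlled.
  have hy1 : ∀ m, ∀ l ≤ m, ∀ n, y 1 * (y 0 ^ l * y 1 ^ n) ∈ W m := by
    intro m
    induction m with
    | zero =>
      intro l hl n
      obtain rfl : l = 0 := by omega
      have := hW (m := 0) (m' := 0) (n := n + 1) 1 le_rfl
      simpa [pow_succ'] using this
    | succ m ih =>
      intro l hl n
      rcases Nat.lt_or_ge l (m + 1) with h | h
      · exact hmono (Nat.le_succ _) (ih l (by omega) n)
      · obtain rfl : l = m + 1 := by omega
        have e : y 1 * (y 0 ^ (m + 1) * y 1 ^ n) = y 0 * (y 1 * (y 0 ^ m * y 1 ^ n)) +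
            j τ₁ * (y 0 ^ (m + 1) * y 1 ^ n) + j τ₂ * (y 1 * (y 0 ^ m * y 1 ^ n)) +
            j τ₀ * (y 0 ^ m * y 1 ^ n) := by
          rw [pow_succ', mul_assoc (y 0), ← mul_assoc (y 1), hrel]
          simp only [add_mul, mul_assoc]
        rw [e]
        exact add_mem (add_mem (add_mem (hstep m m le_rfl ih _ (ih m le_rfl n)).1 (hW _ le_rfl))
          (hS _ _ _ (hmono (Nat.le_succ _) (ih m le_rfl n)))) (hW _ (by omega))
  -- The union of the `W m` is stable under left multiplication by generators, hence by all of `T`;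
  -- it contains `1`.
  have hall : ∀ t : T, ∀ m, ∀ u ∈ W m, ∃ m', t * u ∈ W m' := by
    intro t
    have ht : t ∈ Algebra.adjoin F (Set.range j ∪ {y 0, y 1}) := hgen ▸ Algebra.mem_top
    induction ht using Algebra.adjoin_induction with
    | mem _ h =>
      intro m u hu
      rcases h with ⟨s, rfl⟩ | rfl | rfl
      · exact ⟨m, hS _ _ _ hu⟩
      · exact ⟨_, (hstep m m le_rfl (hy1 m) u hu).1⟩
      · exact ⟨_, (hstep m m le_rfl (hy1 m) u hu).2⟩
    | algebraMap c =>
      intro m u hu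
      rw [← j.commutes]
      exact ⟨m, hS _ _ _ hu⟩
    | add a b _ _ ha hb =>
      intro m u hu
      obtain ⟨m1, h1⟩ := ha m u hu
      obtain ⟨m2, h2⟩ := hb m u hu
      rw [add_mul]
      exact ⟨max m1 m2, add_mem (hmono (le_max_left _ _) h1) (hmono (le_max_right _ _) h2)⟩
    | mul a b _ _ ha hb =>
      intro m u hu
      obtain ⟨m1, h1⟩ := hb m u hu
      obtain ⟨m2, h2⟩ := ha m1 _ h1
      rw [mul_assoc]
      exact ⟨m2, h2⟩
  obtain ⟨m, hm⟩ := hall t 0 1 (by simpa using hW (m := 0) (m' := 0) (n := 0) 1 le_rfl)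
  rw [mul_one] at hm
  have hsum0 : ∀ p : ℕ × ℕ, j 0 * (y 0 ^ p.1 * y 1 ^ p.2) = 0 := by simp
  have hsumadd : ∀ (p : ℕ × ℕ) (s s' : S), j (s + s') * (y 0 ^ p.1 * y 1 ^ p.2) =
      j s * (y 0 ^ p.1 * y 1 ^ p.2) + j s' * (y 0 ^ p.1 * y 1 ^ p.2) := by simp [add_mul]
  induction hm using AddSubgroup.closure_induction with
  | mem _ h =>
    obtain ⟨s, l, n, _, rfl⟩ := h
    exact ⟨Finsupp.single (l, n) s, by simp⟩
  | zero => exact ⟨0, by simp⟩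
  | add _ _ _ _ h1 h2 =>
    obtain ⟨c1, rfl⟩ := h1
    obtain ⟨c2, rfl⟩ := h2
    exact ⟨c1 + c2, Finsupp.sum_add_index' hsum0 hsumadd⟩
  | neg _ _ h1 =>
    obtain ⟨c1, rfl⟩ := h1
    refine ⟨-c1, ?_⟩
    rw [Finsupp.sum_neg_index hsum0, Finsupp.sum, Finsupp.sum, ← Finset.sum_neg_distrib]
    simp

end DoubleExtensionGeneral

/-! ### The relative algebra as a right double extension of `R^e` -/

section RelPoissonEnvPolynomial

open MvPolynomial TensorProduct

variable {k R : Type*} [CommRing k] [CommRing R] [Algebra k R]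

/-- The left `R`-module structure of `R^e`. -/
@[reducible] noncomputable def PoissonEnv.leftModule (π : PoissonBracket k R) :
    Module R (PoissonEnv π) :=
  Module.compHom _ (PoissonEnv.i π).toRingHom

attribute [local instance] PoissonEnv.leftModule

theorem PoissonEnv.smul_eq (π : PoissonBracket k R) (a : R) (u : PoissonEnv π) :
    a • u = PoissonEnv.i π a * u := rfl

theorem polyC_apply (a : R) : polyC k R a = C a := rfl

variable (πR : PoissonBracket k R) (πA : PoissonBracket k (MvPolynomial (Fin 2) R))

/-- The `A`-module `A ⊗ R^e`, on which `A` and `R^e` act from the left. -/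
abbrev PolyTensorEnv : Type _ := MvPolynomial (Fin 2) R ⊗[R] PoissonEnv πR

variable {πR πA} (hf : ∀ a b, polyC k R (πR.br a b) = πA.br (polyC k R a) (polyC k R b))

/-- The action `da (p ⊗ u) = {a, p} ⊗ u + p ⊗ da u`. -/
noncomputable def tensorActAdd (a : R) : PolyTensorEnv πR →+ PolyTensorEnv πR :=
  TensorProduct.liftAddHom
    (AddMonoidHom.mk' (fun p => AddMonoidHom.mk'
        (fun u => πA.br (polyC k R a) p ⊗ₜ[R] u + p ⊗ₜ[R] (PoissonEnv.d πR a * u))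
        (fun u v => by simp only [tmul_add, mul_add]; abel))
      (fun p q => by
        ext u
        simp only [AddMonoidHom.mk'_apply, AddMonoidHom.add_apply, map_add, add_tmul]
        abel))
    (by
      intro r p u
      simp only [AddMonoidHom.mk'_apply]
      -- Neither summand of the action is balanced over `R`. Moving `r` across the tensor sign
      -- produces an extra `{a, r}` in each, and the two extra terms agree.
      have h1 : πA.br (polyC k R a) (r • p) =
          r • πA.br (polyC k R a) p + πR.br a r • p := by
        rw [Algebra.smul_def, Algebra.smul_def, Algebra.smul_def]
        change πA.br _ (polyC k R r * p) = _ + polyC k R _ * p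
        rw [πA.leibniz, hf]
        rw [mul_comm p]
        rfl
      have h2 : PoissonEnv.d πR a * (r • u) =
          πR.br a r • u + r • (PoissonEnv.d πR a * u) := by
        simp only [PoissonEnv.smul_eq, (PoissonEnv.satisfiesP πR).bracket]
        noncomm_ring
      rw [h1, h2, add_tmul, tmul_add, smul_tmul, smul_tmul, smul_tmul]
      abel)

theorem tensorActAdd_tmul (a : R) (p : MvPolynomial (Fin 2) R) (u : PoissonEnv πR) :
    tensorActAdd hf a (p ⊗ₜ[R] u) =
      πA.br (polyC k R a) p ⊗ₜ[R] u + p ⊗ₜ[R] (PoissonEnv.d πR a * u) := rfl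

/-- The action of `da` on `A ⊗ R^e`, as a `k`-linear map. -/
noncomputable def tensorAct (a : R) : Module.End k (PolyTensorEnv πR) where
  toFun := tensorActAdd hf a
  map_add' := map_add _
  map_smul' c z := by
    induction z using TensorProduct.induction_on with
    | zero => simp
    | tmul p u =>
      rw [smul_tmul', tensorActAdd_tmul, tensorActAdd_tmul, map_smul, RingHom.id_apply, smul_add,
        smul_tmul', smul_tmul']
    | add x y hx hy => rw [smul_add, map_add, hx, hy, map_add, smul_add]

theorem tensorAct_tmul (a : R) (p : MvPolynomial (Fin 2) R) (u : PoissonEnv πR) :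
    tensorAct hf a (p ⊗ₜ[R] u) =
      πA.br (polyC k R a) p ⊗ₜ[R] u + p ⊗ₜ[R] (PoissonEnv.d πR a * u) := rfl

theorem tensorEnd_ext {φ ψ : Module.End k (PolyTensorEnv πR)}
    (h : ∀ p u, φ (p ⊗ₜ[R] u) = ψ (p ⊗ₜ[R] u)) : φ = ψ := by
  ext z
  induction z using TensorProduct.induction_on with
  | zero => simp
  | tmul p u => exact h p u
  | add x y hx hy => rw [map_add, map_add, hx, hy]

/-- `A ⊗ R^e` is a module over the relative enveloping algebra. -/
theorem satisfiesRelP_tensorAct :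
    SatisfiesRelP πR πA (polyC k R) (Algebra.lsmul k k (PolyTensorEnv πR))
      { toFun := tensorAct hf
        map_add' := fun a b => tensorEnd_ext fun p u => by
          simp only [tensorAct_tmul, map_add, LinearMap.add_apply, add_tmul, tmul_add, add_mul]
          abel
        map_smul' := fun c a => tensorEnd_ext fun p u => by
          have hk : ∀ v : PoissonEnv πR, (c • p) ⊗ₜ[R] v = p ⊗ₜ[R] (c • v) := by
            intro v
            rw [← algebraMap_smul R c p, smul_tmul, PoissonEnv.smul_eq, AlgHom.commutes,
              Algebra.smul_def]
          simp only [tensorAct_tmul, map_smul, LinearMap.smul_apply, RingHom.id_apply, smul_add,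
            smul_mul_assoc, smul_tmul', hk] } where
  lie a b := tensorEnd_ext fun p u => by
    have h := (PoissonEnv.satisfiesP πR).lie a b
    have h1 := πA.br_br (polyC k R a) (polyC k R b) p
    simp only [LinearMap.coe_mk, AddHom.coe_mk, LinearMap.sub_apply, Module.End.mul_apply,
      tensorAct_tmul, map_add, h, hf, h1, sub_mul, tmul_sub, add_tmul, mul_assoc]
    abel
  bracket a p := tensorEnd_ext fun q u => by
    simp only [LinearMap.coe_mk, AddHom.coe_mk, LinearMap.sub_apply, Module.End.mul_apply,
      tensorAct_tmul, Algebra.lsmul_coe, smul_tmul', smul_eq_mul, πA.leibniz, smul_add, add_tmul]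
    rw [mul_comm q]
    abel
  mul a b := tensorEnd_ext fun p u => by
    have h := (PoissonEnv.satisfiesP πR).mul a b
    have h1 : ∀ (c : R) (v : PoissonEnv πR),
        p ⊗ₜ[R] (PoissonEnv.i πR c * v) = (polyC k R c * p) ⊗ₜ[R] v := by
      intro c v
      rw [← PoissonEnv.smul_eq, ← smul_tmul, Algebra.smul_def]
      rfl
    simp only [LinearMap.coe_mk, AddHom.coe_mk, LinearMap.add_apply, Module.End.mul_apply,
      tensorAct_tmul, Algebra.lsmul_coe, smul_tmul', smul_eq_mul, map_mul, πA.br_mul_left, smul_add,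
      add_tmul, h, add_mul, tmul_add, mul_assoc, h1]
    abel

/-- The action of the relative enveloping algebra on `A ⊗ R^e`. -/
noncomputable def tensorRep :
    RelPoissonEnv πR πA (polyC k R) →ₐ[k] Module.End k (PolyTensorEnv πR) :=
  RelPoissonEnv.lift _ _ (satisfiesRelP_tensorAct hf)

/-- Since `{a, 1} = 0`, the action of `da` on `1 ⊗ u` has no polynomial part. -/
theorem tensorRep_ofEnv (s u : PoissonEnv πR) :
    tensorRep hf (RelPoissonEnv.ofEnv hf s) ((1 : MvPolynomial (Fin 2) R) ⊗ₜ[R] u) =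
      (1 : MvPolynomial (Fin 2) R) ⊗ₜ[R] (s * u) := by
  induction s using PoissonEnv.induction generalizing u with
  | hi a =>
    rw [RelPoissonEnv.ofEnv, PoissonEnv.lift_i, AlgHom.comp_apply, tensorRep,
      RelPoissonEnv.lift_i, ← PoissonEnv.smul_eq, ← smul_tmul, Algebra.smul_def a]
    rfl
  | hd a =>
    rw [RelPoissonEnv.ofEnv, PoissonEnv.lift_d, tensorRep, RelPoissonEnv.lift_d]
    change tensorAct hf a _ = _
    rw [tensorAct_tmul, πA.br_one, zero_tmul, zero_add]
  | hadd s t hs ht =>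
    rw [map_add, map_add, LinearMap.add_apply, hs, ht, add_mul, tmul_add]
  | hmul s t hs ht =>
    rw [map_mul, map_mul, Module.End.mul_apply, ht, hs, mul_assoc]

/-- The vector `1 ⊗ 1` separates the products `p * s`: relations among them would already hold in
the tensor product. -/
theorem tensorRep_i_mul (p : MvPolynomial (Fin 2) R) (s : PoissonEnv πR) :
    tensorRep hf (RelPoissonEnv.i πR πA _ p * RelPoissonEnv.ofEnv hf s)
      ((1 : MvPolynomial (Fin 2) R) ⊗ₜ[R] (1 : PoissonEnv πR)) = p ⊗ₜ[R] s := by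
  rw [map_mul, Module.End.mul_apply, tensorRep_ofEnv, mul_one, tensorRep, RelPoissonEnv.lift_i]
  simp only [Algebra.lsmul_coe, smul_tmul', smul_eq_mul, mul_one]

variable (πR) in
/-- The coefficient of a monomial in an element of `A ⊗ R^e`. -/
noncomputable def tensorCoeff (m : Fin 2 →₀ ℕ) : PolyTensorEnv πR →ₗ[R] PoissonEnv πR :=
  (TensorProduct.lid R (PoissonEnv πR)).toLinearMap ∘ₗ
    LinearMap.rTensor (PoissonEnv πR) (MvPolynomial.lcoeff R m)

variable (πR) in
theorem tensorCoeff_monomial (m n : Fin 2 →₀ ℕ) (s : PoissonEnv πR) :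
    tensorCoeff πR m (monomial n (1 : R) ⊗ₜ[R] s) = if n = m then s else 0 := by
  classical
  simp only [tensorCoeff, LinearMap.comp_apply, LinearMap.rTensor_tmul, lcoeff_apply,
    coeff_monomial, LinearEquiv.coe_coe, TensorProduct.lid_tmul]
  split_ifs <;> simp

theorem X_pow_mul_X_pow (m n : ℕ) : (X 1 ^ m * X 0 ^ n : MvPolynomial (Fin 2) R) =
    monomial (Finsupp.single 1 m + Finsupp.single 0 n) 1 := by
  rw [X_pow_eq_monomial, X_pow_eq_monomial, monomial_mul, one_mul]

theorem single_add_single_inj {p q : ℕ × ℕ} :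
    (Finsupp.single 1 p.1 + Finsupp.single 0 p.2 : Fin 2 →₀ ℕ) =
      Finsupp.single 1 q.1 + Finsupp.single 0 q.2 ↔ p = q := by
  constructor
  · intro h
    have h0 := DFunLike.congr_fun h 0
    have h1 := DFunLike.congr_fun h 1
    simp at h0 h1
    exact Prod.ext h1 h0
  · rintro rfl
    rfl

/-- The variables `x₁`, `x₂` in the relative enveloping algebra. -/
noncomputable def relVar (πR : PoissonBracket k R) (πA : PoissonBracket k (MvPolynomial (Fin 2) R))
    (r : Fin 2) : RelPoissonEnv πR πA (polyC k R) :=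
  RelPoissonEnv.i πR πA _ (X r)

/-- The coefficients are recovered by acting on `1 ⊗ 1` and taking coefficients of monomials, which
works because `A` is free over `R`. -/
theorem relEnv_basis_injective : Function.Injective
    (fun c : ℕ × ℕ →₀ PoissonEnv πR => c.sum fun p s =>
      (relVar πR πA 1 ^ p.1 * relVar πR πA 0 ^ p.2) * RelPoissonEnv.ofEnv hf s) := by
  have key : ∀ (c : ℕ × ℕ →₀ PoissonEnv πR) (q : ℕ × ℕ),
      tensorCoeff πR (Finsupp.single 1 q.1 + Finsupp.single 0 q.2)
        (tensorRep hf (c.sum fun p s =>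
          (relVar πR πA 1 ^ p.1 * relVar πR πA 0 ^ p.2) * RelPoissonEnv.ofEnv hf s)
          ((1 : MvPolynomial (Fin 2) R) ⊗ₜ[R] (1 : PoissonEnv πR))) = c q := by
    intro c q
    rw [Finsupp.sum, map_sum, LinearMap.sum_apply, map_sum]
    simp only [relVar, ← map_pow, ← map_mul (RelPoissonEnv.i πR πA (polyC k R)), tensorRep_i_mul,
      X_pow_mul_X_pow, tensorCoeff_monomial, single_add_single_inj]
    simp
  intro c c' h
  ext q
  rw [← key c q, ← key c' q]
  exact congrArg (fun z => tensorCoeff πR _ (tensorRep hf z _)) h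

theorem ofEnv_injective : Function.Injective (RelPoissonEnv.ofEnv hf) := by
  intro s t h
  have := relEnv_basis_injective hf (a₁ := Finsupp.single (0, 0) s)
    (a₂ := Finsupp.single (0, 0) t) (by simp [h])
  exact Finsupp.single_injective _ this

theorem ofEnv_i (a : R) : RelPoissonEnv.ofEnv hf (PoissonEnv.i πR a) =
    RelPoissonEnv.i πR πA _ (polyC k R a) := by
  simp [RelPoissonEnv.ofEnv]

theorem ofEnv_d (a : R) : RelPoissonEnv.ofEnv hf (PoissonEnv.d πR a) =
    RelPoissonEnv.d πR πA (polyC k R) a := by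
  simp [RelPoissonEnv.ofEnv]

theorem relEnv_basis_surjective : Function.Surjective
    (fun c : ℕ × ℕ →₀ PoissonEnv πR => c.sum fun p s =>
      (relVar πR πA 1 ^ p.1 * relVar πR πA 0 ^ p.2) * RelPoissonEnv.ofEnv hf s) := by
  let W : AddSubgroup (RelPoissonEnv πR πA (polyC k R)) := AddSubgroup.closure
    {u | ∃ p s, u = RelPoissonEnv.i πR πA _ p * RelPoissonEnv.ofEnv hf s}
  -- The sums of products `p * s` form a left ideal: `da` passes `p` at the cost of `{a, p}`, and is
  -- then absorbed into `R^e`.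
  have hW : ∀ u w, w ∈ W → u * w ∈ W := by
    intro u
    induction u using RelPoissonEnv.induction with
    | hi q =>
      intro w hw
      induction hw using AddSubgroup.closure_induction with
      | mem _ h =>
        obtain ⟨p, s, rfl⟩ := h
        rw [← mul_assoc, ← map_mul]
        exact AddSubgroup.subset_closure ⟨_, _, rfl⟩
      | zero => simp
      | add _ _ _ _ h1 h2 => rw [mul_add]; exact add_mem h1 h2
      | neg _ _ h1 => rw [mul_neg]; exact neg_mem h1
    | hd a =>
      intro w hw
      induction hw using AddSubgroup.closure_induction with
      | mem _ h =>
        obtain ⟨p, s, rfl⟩ := h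
        have e : RelPoissonEnv.d πR πA (polyC k R) a *
            (RelPoissonEnv.i πR πA _ p * RelPoissonEnv.ofEnv hf s) =
            RelPoissonEnv.i πR πA _ (πA.br (polyC k R a) p) * RelPoissonEnv.ofEnv hf s +
            RelPoissonEnv.i πR πA _ p * RelPoissonEnv.ofEnv hf (PoissonEnv.d πR a * s) := by
          rw [(RelPoissonEnv.satisfiesRelP πR πA (polyC k R)).bracket, map_mul, ofEnv_d]
          noncomm_ring
        rw [e]
        exact add_mem (AddSubgroup.subset_closure ⟨_, _, rfl⟩)
          (AddSubgroup.subset_closure ⟨_, _, rfl⟩)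
      | zero => simp
      | add _ _ _ _ h1 h2 => rw [mul_add]; exact add_mem h1 h2
      | neg _ _ h1 => rw [mul_neg]; exact neg_mem h1
    | hadd u v hu hv => intro w hw; rw [add_mul]; exact add_mem (hu w hw) (hv w hw)
    | hmul u v hu hv => intro w hw; rw [mul_assoc]; exact hu _ (hv w hw)
  have h0 : ∀ p : ℕ × ℕ, (relVar πR πA 1 ^ p.1 * relVar πR πA 0 ^ p.2) *
      RelPoissonEnv.ofEnv hf 0 = 0 := by simp
  have hadd : ∀ (p : ℕ × ℕ) (s s' : PoissonEnv πR),
      (relVar πR πA 1 ^ p.1 * relVar πR πA 0 ^ p.2) * RelPoissonEnv.ofEnv hf (s + s') =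
      (relVar πR πA 1 ^ p.1 * relVar πR πA 0 ^ p.2) * RelPoissonEnv.ofEnv hf s +
      (relVar πR πA 1 ^ p.1 * relVar πR πA 0 ^ p.2) * RelPoissonEnv.ofEnv hf s' := by
    simp [mul_add]
  intro u
  have hu := hW u 1 (AddSubgroup.subset_closure ⟨1, 1, by simp⟩)
  rw [mul_one] at hu
  induction hu using AddSubgroup.closure_induction with
  | mem _ h =>
    obtain ⟨p, s, rfl⟩ := h
    induction p using MvPolynomial.induction_on' with
    | monomial m a =>
      -- The coefficient of the monomial lies in `R` and commutes with the variables, so it moves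
      -- right into `R^e`. The exponent of `x₂` is listed first, as in the basis of a right
      -- extension.
      refine ⟨Finsupp.single (m 1, m 0) (PoissonEnv.i πR a * s), ?_⟩
      have hm : m = Finsupp.single 1 (m 1) + Finsupp.single 0 (m 0) := by
        ext r
        fin_cases r <;> simp
      have e : (monomial m a : MvPolynomial (Fin 2) R) =
          X 1 ^ m 1 * X 0 ^ m 0 * polyC k R a := by
        rw [X_pow_mul_X_pow, ← hm, polyC_apply, mul_comm, C_mul_monomial, mul_one]
      simp only [e, map_mul, map_pow, mul_assoc]
      rw [Finsupp.sum_single_index (by simp)]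
      simp only [map_mul, ofEnv_i, relVar]
    | add p q hp hq =>
      obtain ⟨c1, h1⟩ := hp
      obtain ⟨c2, h2⟩ := hq
      refine ⟨c1 + c2, ?_⟩
      simp only [map_add, add_mul, ← h1, ← h2]
      exact Finsupp.sum_add_index' h0 hadd
  | zero => exact ⟨0, by simp⟩
  | add _ _ _ _ h1 h2 =>
    obtain ⟨c1, rfl⟩ := h1
    obtain ⟨c2, rfl⟩ := h2
    exact ⟨c1 + c2, Finsupp.sum_add_index' h0 hadd⟩
  | neg _ _ h1 =>
    obtain ⟨c1, rfl⟩ := h1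
    refine ⟨-c1, ?_⟩
    simp only []
    rw [Finsupp.sum_neg_index h0, Finsupp.sum, Finsupp.sum, ← Finset.sum_neg_distrib]
    simp

theorem relEnv_generates : Algebra.adjoin k (Set.range (RelPoissonEnv.ofEnv hf) ∪
    {relVar πR πA 0, relVar πR πA 1}) = ⊤ := by
  rw [eq_top_iff]
  rintro u -
  obtain ⟨c, rfl⟩ := relEnv_basis_surjective hf u
  have hx : ∀ r, relVar πR πA r ∈ Algebra.adjoin k (Set.range (RelPoissonEnv.ofEnv hf) ∪
      {relVar πR πA 0, relVar πR πA 1}) := by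
    intro r
    apply Algebra.subset_adjoin
    fin_cases r
    · exact Or.inr (Or.inl rfl)
    · exact Or.inr (Or.inr rfl)
  exact sum_mem fun p _ => mul_mem (mul_mem (pow_mem (hx 1) _) (pow_mem (hx 0) _))
    (Algebra.subset_adjoin (Or.inl ⟨_, rfl⟩))

/-- The relative enveloping algebra of `R → R[x₁, x₂]` is a right double extension of `R^e` if the
brackets `{x_r, a}` are polynomials of degree at most one. -/
theorem relEnv_isRightDoubleExtension
    (hlin : ∀ (a : R) (r : Fin 2), ∃ u v w : R, πA.br (X r) (polyC k R a) =
      polyC k R u * X 0 + polyC k R v * X 1 + polyC k R w) :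
    IsRightDoubleExtension (RelPoissonEnv.ofEnv hf) (relVar πR πA) where
  injective := ofEnv_injective hf
  generates := relEnv_generates hf
  relation := ⟨0, 1, 0, 0, 0, by
    have h : relVar πR πA 0 * relVar πR πA 1 = relVar πR πA 1 * relVar πR πA 0 := by
      rw [relVar, relVar, ← map_mul, mul_comm, map_mul]
    simp [h]⟩
  basis := ⟨relEnv_basis_injective hf, relEnv_basis_surjective hf⟩
  subset := by
    have key : ∀ (s : PoissonEnv πR) (r : Fin 2), ∃ a b c : PoissonEnv πR,
        RelPoissonEnv.ofEnv hf s * relVar πR πA r = relVar πR πA 0 * RelPoissonEnv.ofEnv hf a +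
          relVar πR πA 1 * RelPoissonEnv.ofEnv hf b + RelPoissonEnv.ofEnv hf c := by
      intro s
      induction s using PoissonEnv.induction with
      | hi a =>
        intro r
        have e : RelPoissonEnv.ofEnv hf (PoissonEnv.i πR a) * relVar πR πA r =
            relVar πR πA r * RelPoissonEnv.ofEnv hf (PoissonEnv.i πR a) := by
          simp only [ofEnv_i, relVar, ← map_mul, mul_comm]
        fin_cases r
        · exact ⟨PoissonEnv.i πR a, 0, 0, by simpa using e⟩
        · exact ⟨0, PoissonEnv.i πR a, 0, by simpa using e⟩
      | hd a =>
        intro r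
        obtain ⟨u, v, w, h⟩ := hlin a r
        -- Linearity of `{x_r, a}` is what keeps `da * x_r` in the span of `x₁, x₂, 1` over `R^e`;
        -- the bracket enters with a minus sign because `da` stands on the left.
        have h1 := (RelPoissonEnv.satisfiesRelP πR πA (polyC k R)).bracket a (X r)
        rw [πA.br_skew, h, mul_comm _ (X 0), mul_comm _ (X 1)] at h1
        have e : RelPoissonEnv.ofEnv hf (PoissonEnv.d πR a) * relVar πR πA r =
            relVar πR πA r * RelPoissonEnv.ofEnv hf (PoissonEnv.d πR a) -
            (relVar πR πA 0 * RelPoissonEnv.ofEnv hf (PoissonEnv.i πR u) +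
              relVar πR πA 1 * RelPoissonEnv.ofEnv hf (PoissonEnv.i πR v) +
              RelPoissonEnv.ofEnv hf (PoissonEnv.i πR w)) := by
          simp only [ofEnv_d, ofEnv_i, relVar, ← map_mul, ← map_add]
          rw [sub_eq_add_neg, ← map_neg, h1]
          abel
        fin_cases r
        · refine ⟨PoissonEnv.d πR a - PoissonEnv.i πR u, -PoissonEnv.i πR v,
            -PoissonEnv.i πR w, ?_⟩
          refine e.trans ?_
          simp only [map_sub, map_neg, mul_sub, mul_neg, Fin.zero_eta]
          abel
        · refine ⟨-PoissonEnv.i πR u, PoissonEnv.d πR a - PoissonEnv.i πR v,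
            -PoissonEnv.i πR w, ?_⟩
          refine e.trans ?_
          simp only [map_sub, map_neg, mul_sub, mul_neg, Fin.mk_one]
          abel
      | hadd s t hs ht =>
        intro r
        obtain ⟨a, b, c, h⟩ := hs r
        obtain ⟨a', b', c', h'⟩ := ht r
        refine ⟨a + a', b + b', c + c', ?_⟩
        simp only [map_add, add_mul, mul_add, h, h']
        abel
      | hmul s t hs ht =>
        intro r
        obtain ⟨a, b, c, h⟩ := ht r
        -- Moving `t` past one variable creates both, so `s` must be moved past both; hence the
        -- induction keeps `r` universally quantified.
        obtain ⟨a0, b0, c0, h0⟩ := hs 0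
        obtain ⟨a1, b1, c1, h1⟩ := hs 1
        refine ⟨a0 * a + a1 * b, b0 * a + b1 * b, c0 * a + c1 * b + s * c, ?_⟩
        rw [map_mul, mul_assoc, h, mul_add, mul_add, ← mul_assoc, ← mul_assoc, h0, h1]
        simp only [map_add, map_mul, add_mul, mul_add, mul_assoc]
        abel
    intro a b c
    obtain ⟨a0, b0, c0, h0⟩ := key a 0
    obtain ⟨a1, b1, c1, h1⟩ := key b 1
    refine ⟨a0 + a1, b0 + b1, c0 + c1 + c, ?_⟩
    rw [h0, h1]
    simp only [map_add, mul_add]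
    abel

end RelPoissonEnvPolynomial

/-! ### Operators on the free module with basis the ordered monomials -/

/-- `σ` and `δ` are the components of an algebra homomorphism `S → M₃(S)` of the form
`a ↦ (σ(a), δ(a); 0, a)`. -/
structure IsCrossing {F S : Type*} [CommRing F] [Ring S] [Algebra F S]
    (σ : Fin 2 → Fin 2 → S →ₗ[F] S) (δ : Fin 2 → S →ₗ[F] S) : Prop where
  σ_one : ∀ r l, σ r l 1 = if r = l then 1 else 0
  δ_one : ∀ r, δ r 1 = 0
  σ_mul : ∀ r l a b, σ r l (a * b) = σ r 0 a * σ 0 l b + σ r 1 a * σ 1 l b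
  δ_mul : ∀ r a b, δ r (a * b) = σ r 0 a * δ 0 b + σ r 1 a * δ 1 b + δ r a * b

namespace IsCrossing

variable {F S : Type*} [CommRing F] [Ring S] [Algebra F S]
  (σ : Fin 2 → Fin 2 → S →ₗ[F] S) (δ : Fin 2 → S →ₗ[F] S) (τ₁ τ₂ τ₀ : S)

/-- The normal form of `y₂ y₁ ^ m y₂ ^ n`. -/
noncomputable def straighten : ℕ → ℕ → (ℕ × ℕ →₀ S)
  | 0, n => Finsupp.single (0, n + 1) 1
  -- This rewrites `y₂ y₁` at the left end and lets the resulting outer `y₁` act on the normal form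
  -- of `y₂ y₁ ^ m y₂ ^ n`. The test `p.1 ≤ m` serves termination; by `straighten_support` it
  -- succeeds at every `p` that occurs.
  | m + 1, n => ((straighten m n).sum fun p s => Finsupp.single (p.1 + 1, p.2) (σ 0 0 s) +
      (if _h : p.1 ≤ m then σ 0 1 s • straighten p.1 p.2 else 0) + Finsupp.single p (δ 0 s)) +
      Finsupp.single (m + 1, n) τ₁ + τ₂ • straighten m n + Finsupp.single (m, n) τ₀
  termination_by m => m

/-- Straightening does not raise the `y₁`-degree. This is what makes the guarded recursion agree
with the intended one. -/
theorem straighten_support (m n : ℕ) (p : ℕ × ℕ) (hp : m < p.1) :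
    straighten σ δ τ₁ τ₂ τ₀ m n p = 0 := by
  induction m using Nat.strong_induction_on generalizing n p with
  | _ m ih =>
    cases m with
    | zero =>
      rw [straighten, Finsupp.single_apply, if_neg]
      rintro rfl
      exact lt_irrefl _ hp
    | succ m =>
      rw [straighten]
      have h1 : ∀ (q : ℕ × ℕ) (s : S), q.1 < p.1 → Finsupp.single q s p = 0 := by
        intro q s hq
        rw [Finsupp.single_apply, if_neg]
        rintro rfl
        exact lt_irrefl _ hq
      have h2 : ∀ l n', l ≤ m → straighten σ δ τ₁ τ₂ τ₀ l n' p = 0 :=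
        fun l n' hl => ih l (by omega) n' p (by omega)
      simp only [Finsupp.add_apply, Finsupp.smul_apply, smul_eq_mul]
      rw [h1 (m + 1, n) _ hp, h1 (m, n) _ (by simp; omega), h2 m n le_rfl, mul_zero, Finsupp.sum,
        Finsupp.finsetSum_apply, Finset.sum_eq_zero]
      · simp
      intro q hq
      have hqm : q.1 ≤ m := by
        by_contra h
        exact (Finsupp.mem_support_iff.mp hq) (ih m (by omega) n q (by omega))
      rw [dif_pos hqm, Finsupp.add_apply, Finsupp.add_apply, Finsupp.smul_apply, h2 _ _ hqm,
        h1 _ _ (by simp; omega), h1 _ _ (by omega)]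
      simp

/-- The operators of multiplication by `y₁` and `y₂` on the free module on the ordered
monomials. -/
noncomputable def varOp (r : Fin 2) : Module.End F (ℕ × ℕ →₀ S) :=
  Finsupp.lsum F fun p => (Finsupp.lsingle (p.1 + 1, p.2)).comp (σ r 0) +
    ((LinearMap.toSpanSingleton S _ (straighten σ δ τ₁ τ₂ τ₀ p.1 p.2)).restrictScalars F).comp
      (σ r 1) + (Finsupp.lsingle p).comp (δ r)

theorem varOp_single (r : Fin 2) (p : ℕ × ℕ) (s : S) :
    varOp σ δ τ₁ τ₂ τ₀ r (Finsupp.single p s) = Finsupp.single (p.1 + 1, p.2) (σ r 0 s) +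
      σ r 1 s • straighten σ δ τ₁ τ₂ τ₀ p.1 p.2 + Finsupp.single p (δ r s) := by
  simp [varOp]

/-- The recursion without its guard: the summation over the support is the operator `y₁` applied to
the earlier normal form. -/
theorem straighten_succ (m n : ℕ) : straighten σ δ τ₁ τ₂ τ₀ (m + 1) n =
    varOp σ δ τ₁ τ₂ τ₀ 0 (straighten σ δ τ₁ τ₂ τ₀ m n) + Finsupp.single (m + 1, n) τ₁ +
      τ₂ • straighten σ δ τ₁ τ₂ τ₀ m n + Finsupp.single (m, n) τ₀ := by
  rw [straighten]
  congr 3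
  rw [varOp, Finsupp.lsum_apply, Finsupp.sum, Finsupp.sum]
  refine Finset.sum_congr rfl fun p hp => ?_
  have hpm : p.1 ≤ m := by
    by_contra h
    exact (Finsupp.mem_support_iff.mp hp) (straighten_support _ _ _ _ _ _ _ _ (by omega))
  rw [dif_pos hpm]
  rfl

variable {σ δ}

/-- On a basis vector with coefficient `s` this is the multiplicativity of the crossing matrices at
the product `b * s`; the quadratic relation plays no role. -/
theorem varOp_smul (h : IsCrossing σ δ) (r : Fin 2) (b : S) (v : ℕ × ℕ →₀ S) :
    varOp σ δ τ₁ τ₂ τ₀ r (b • v) = σ r 0 b • varOp σ δ τ₁ τ₂ τ₀ 0 v +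
      σ r 1 b • varOp σ δ τ₁ τ₂ τ₀ 1 v + δ r b • v := by
  induction v using Finsupp.induction_linear with
  | zero => simp
  | add v w hv hw =>
    rw [smul_add, map_add, hv, hw, map_add, map_add]
    simp only [smul_add]
    abel
  | single p s =>
    simp only [varOp_single, Finsupp.smul_single, smul_eq_mul, h.σ_mul, h.δ_mul, smul_add,
      Finsupp.single_add, add_smul, mul_smul]
    abel

theorem varOp_zero_single_one (h : IsCrossing σ δ) (p : ℕ × ℕ) :
    varOp σ δ τ₁ τ₂ τ₀ 0 (Finsupp.single p 1) = Finsupp.single (p.1 + 1, p.2) 1 := by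
  simp [varOp_single, h.σ_one, h.δ_one]

theorem varOp_one_single_one (h : IsCrossing σ δ) (p : ℕ × ℕ) :
    varOp σ δ τ₁ τ₂ τ₀ 1 (Finsupp.single p 1) = straighten σ δ τ₁ τ₂ τ₀ p.1 p.2 := by
  simp [varOp_single, h.σ_one, h.δ_one]

/-- The operators satisfy the quadratic relation on the basis. -/
theorem varOp_relation_single_one (h : IsCrossing σ δ) (p : ℕ × ℕ) :
    varOp σ δ τ₁ τ₂ τ₀ 1 (varOp σ δ τ₁ τ₂ τ₀ 0 (Finsupp.single p 1)) =
      varOp σ δ τ₁ τ₂ τ₀ 0 (varOp σ δ τ₁ τ₂ τ₀ 1 (Finsupp.single p 1)) +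
      τ₁ • varOp σ δ τ₁ τ₂ τ₀ 0 (Finsupp.single p 1) +
      τ₂ • varOp σ δ τ₁ τ₂ τ₀ 1 (Finsupp.single p 1) + τ₀ • Finsupp.single p 1 := by
  -- On unit vectors `y₁` only shifts the exponent, so the claim is the recursion defining
  -- `straighten`.
  rw [varOp_zero_single_one _ _ _ h, varOp_one_single_one _ _ _ h, varOp_one_single_one _ _ _ h,
    straighten_succ]
  simp

/-- The vector at `(0, 0)` is carried by the ordered monomials to distinct basis vectors, which
makes these monomials independent in any algebra acting this way. -/
theorem varOp_pow_single (h : IsCrossing σ δ) (m n : ℕ) :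
    (varOp σ δ τ₁ τ₂ τ₀ 0 ^ m * varOp σ δ τ₁ τ₂ τ₀ 1 ^ n) (Finsupp.single (0, 0) 1) =
      Finsupp.single (m, n) 1 := by
  have h1 : (varOp σ δ τ₁ τ₂ τ₀ 1 ^ n) (Finsupp.single (0, 0) 1) = Finsupp.single (0, n) 1 := by
    induction n with
    | zero => simp
    | succ n ih =>
      rw [pow_succ', Module.End.mul_apply, ih, varOp_one_single_one _ _ _ h, straighten]
  rw [Module.End.mul_apply, h1]
  induction m with
  | zero => simp
  | succ m ih => rw [pow_succ', Module.End.mul_apply, ih, varOp_zero_single_one _ _ _ h]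

end IsCrossing

/-! ### Extending derivations from `R` to polynomials, and their commutators -/

section PolynomialDerivation

open MvPolynomial

variable {k R U : Type*} [CommRing k] [CommRing R] [Algebra k R] [Ring U] [Algebra k U]

/-- Arbitrary products are allowed in the last step, which suits identities whose two sides are
derivations in `p`. -/
theorem poly_induction {P : MvPolynomial (Fin 2) R → Prop} (hC : ∀ a, P (C a))
    (hX : ∀ r, P (X r)) (hadd : ∀ p q, P p → P q → P (p + q))
    (hmul : ∀ p q, P p → P q → P (p * q)) (p : MvPolynomial (Fin 2) R) : P p := by
  induction p using MvPolynomial.induction_on with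
  | C a => exact hC a
  | add p q hp hq => exact hadd p q hp hq
  | mul_X p r hp => exact hmul p _ hp (hX r)

theorem pderiv_polyC (l : Fin 2) (a : R) : pderiv l (polyC k R a) = 0 := pderiv_C

theorem pderiv_mul' (l : Fin 2) (p q : MvPolynomial (Fin 2) R) :
    pderiv l (p * q) = p * pderiv l q + q * pderiv l p := by
  rw [pderiv_mul]
  ring

variable (g : MvPolynomial (Fin 2) R →ₐ[k] U) (d : R →ₗ[k] U)

/-- The coefficientwise extension of a derivation `d : R → U` to polynomials. -/
noncomputable def coeffDeriv : MvPolynomial (Fin 2) R →ₗ[k] U :=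
  (Finsupp.lsum k fun m => (LinearMap.mulLeft k (g (monomial m 1))).comp d).comp
    (AddMonoidAlgebra.coeffLinearEquiv k).toLinearMap

theorem coeffDeriv_monomial (m : Fin 2 →₀ ℕ) (a : R) :
    coeffDeriv g d (monomial m a) = g (monomial m 1) * d a := by
  change (Finsupp.lsum k fun m => (LinearMap.mulLeft k (g (monomial m 1))).comp d)
    (Finsupp.single m a) = _
  rw [Finsupp.lsum_single]
  rfl

theorem coeffDeriv_polyC (a : R) : coeffDeriv g d (polyC k R a) = d a := by
  rw [polyC_apply, C_apply, coeffDeriv_monomial]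
  change g 1 * _ = _
  rw [map_one, one_mul]

variable {g d}

theorem coeffDeriv_X (hd : ∀ a b, d (a * b) = g (polyC k R a) * d b + g (polyC k R b) * d a)
    (r : Fin 2) : coeffDeriv g d (X r) = 0 := by
  have h1 : d 1 = 0 := by
    have := hd 1 1
    simpa using this
  rw [X, coeffDeriv_monomial, h1, mul_zero]

/-- Although `U` is noncommutative, values of `g` stand to the left of values of `d` throughout, and
values of `g` commute with each other. -/
theorem coeffDeriv_mul (hd : ∀ a b, d (a * b) = g (polyC k R a) * d b + g (polyC k R b) * d a)
    (p q : MvPolynomial (Fin 2) R) :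
    coeffDeriv g d (p * q) = g p * coeffDeriv g d q + g q * coeffDeriv g d p := by
  induction p using MvPolynomial.induction_on' with
  | monomial m a =>
    induction q using MvPolynomial.induction_on' with
    | monomial n b =>
      have e : ∀ (m : Fin 2 →₀ ℕ) (a : R), (monomial m a : MvPolynomial (Fin 2) R) =
          monomial m 1 * polyC k R a := by
        intro m a
        rw [polyC_apply, mul_comm, C_mul_monomial, mul_one]
      have e1 : (monomial (m + n) 1 : MvPolynomial (Fin 2) R) = monomial m 1 * monomial n 1 := by
        rw [monomial_mul, mul_one]
      rw [monomial_mul, coeffDeriv_monomial, coeffDeriv_monomial, coeffDeriv_monomial, hd, mul_add,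
        ← mul_assoc, ← mul_assoc, ← mul_assoc, ← mul_assoc, ← map_mul, ← map_mul, ← map_mul,
        ← map_mul, e m a, e n b, e1]
      congr 3 <;> ring
    | add p q hp hq => simp only [mul_add, map_add, hp, hq, add_mul]; abel
  | add p q hp hq => simp only [mul_add, map_add, hp, hq, add_mul]; abel

/-- A derivation of `R` extends to `R[x₁, x₂]` with prescribed values at the variables. -/
noncomputable def derivExt (g : MvPolynomial (Fin 2) R →ₐ[k] U) (d : R →ₗ[k] U) (n : Fin 2 → U) :
    MvPolynomial (Fin 2) R →ₗ[k] U :=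
  coeffDeriv g d + ∑ l, (LinearMap.mulRight k (n l)).comp
    (g.toLinearMap.comp ((pderiv l).toLinearMap.restrictScalars k))

variable (n : Fin 2 → U)

theorem derivExt_apply (p : MvPolynomial (Fin 2) R) : derivExt g d n p =
    coeffDeriv g d p + (g (pderiv 0 p) * n 0 + g (pderiv 1 p) * n 1) := by
  simp [derivExt, Fin.sum_univ_two]

theorem derivExt_polyC (a : R) : derivExt g d n (polyC k R a) = d a := by
  rw [derivExt_apply, coeffDeriv_polyC, pderiv_polyC, pderiv_polyC]
  simp

theorem derivExt_X (hd : ∀ a b, d (a * b) = g (polyC k R a) * d b + g (polyC k R b) * d a)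
    (r : Fin 2) : derivExt g d n (X r) = n r := by
  rw [derivExt_apply, coeffDeriv_X hd, pderiv_X, pderiv_X]
  fin_cases r <;> simp

theorem derivExt_mul (hd : ∀ a b, d (a * b) = g (polyC k R a) * d b + g (polyC k R b) * d a)
    (p q : MvPolynomial (Fin 2) R) :
    derivExt g d n (p * q) = g p * derivExt g d n q + g q * derivExt g d n p := by
  simp only [derivExt_apply, coeffDeriv_mul hd, pderiv_mul', map_add, map_mul, add_mul, mul_add,
    mul_assoc]
  abel

section Commutators

variable {πR : PoissonBracket k R} {πA : PoissonBracket k (MvPolynomial (Fin 2) R)}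

/-- In `A^e` the coefficientwise derivative of `q` is `dq - ∂₁q dx₁ - ∂₂q dx₂`, and `[dq, p] = {q,
p}` suggests the formula. Here, where `dx₁, dx₂` do not exist, it holds because both sides are
derivations in `q` that agree on `R` and the variables. -/
theorem coeffDeriv_comm_left (h : SatisfiesRelP πR πA (polyC k R) g d)
    (q p : MvPolynomial (Fin 2) R) :
    coeffDeriv g d q * g p - g p * coeffDeriv g d q =
      g (πA.br q p - pderiv 0 q * πA.br (X 0) p - pderiv 1 q * πA.br (X 1) p) := by
  induction q using poly_induction with
  | hC a =>
    rw [← polyC_apply (k := k), coeffDeriv_polyC, pderiv_polyC, pderiv_polyC, ← h.bracket]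
    simp
  | hX r =>
    rw [coeffDeriv_X h.mul, pderiv_X, pderiv_X]
    fin_cases r <;> simp
  | hadd q q' hq hq' =>
    have e : ∀ u v w : U, (u + v) * w - w * (u + v) = (u * w - w * u) + (v * w - w * v) := by
      intros; noncomm_ring
    rw [map_add, e, hq, hq', ← map_add]
    congr 1
    simp only [map_add, LinearMap.add_apply]
    ring
  | hmul q q' hq hq' =>
    have c1 : g p * g q = g q * g p := by rw [← map_mul, mul_comm, map_mul]
    have c2 : g p * g q' = g q' * g p := by rw [← map_mul, mul_comm, map_mul]
    have e : coeffDeriv g d (q * q') * g p - g p * coeffDeriv g d (q * q') =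
        g q * (coeffDeriv g d q' * g p - g p * coeffDeriv g d q') +
        g q' * (coeffDeriv g d q * g p - g p * coeffDeriv g d q) := by
      rw [coeffDeriv_mul h.mul, mul_add, ← mul_assoc (g p), ← mul_assoc (g p), c1, c2]
      noncomm_ring
    rw [e, hq, hq', ← map_mul, ← map_mul, ← map_add]
    congr 1
    rw [πA.br_mul_left, pderiv_mul', pderiv_mul']
    ring

/-- This is the part of `[da, dq] = d{a, q}` free of `dx₁, dx₂`. The first term on the right is not
a derivation in `q`, but its difference from the commutator is. -/
theorem coeffDeriv_comm_right
    (hf : ∀ a b, polyC k R (πR.br a b) = πA.br (polyC k R a) (polyC k R b))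
    (h : SatisfiesRelP πR πA (polyC k R) g d) (a : R)
    (q : MvPolynomial (Fin 2) R) :
    d a * coeffDeriv g d q - coeffDeriv g d q * d a = coeffDeriv g d (πA.br (polyC k R a) q) -
      g (pderiv 0 q) * coeffDeriv g d (πA.br (polyC k R a) (X 0)) -
      g (pderiv 1 q) * coeffDeriv g d (πA.br (polyC k R a) (X 1)) := by
  have m : ∀ p x, d a * (g p * x) = g p * (d a * x) + g (πA.br (polyC k R a) p) * x := by
    intro p x
    rw [h.bracket]
    noncomm_ring
  induction q using poly_induction with
  | hC b =>
    rw [← polyC_apply (k := k), ← hf, coeffDeriv_polyC, coeffDeriv_polyC, pderiv_polyC, pderiv_polyC, h.lie]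
    simp
  | hX r =>
    rw [coeffDeriv_X h.mul, pderiv_X, pderiv_X]
    fin_cases r <;> simp
  | hadd q q' hq hq' =>
    have e : ∀ u v w : U, w * (u + v) - (u + v) * w = (w * u - u * w) + (w * v - v * w) := by
      intros; noncomm_ring
    rw [map_add, e, hq, hq']
    simp only [map_add, add_mul]
    abel
  | hmul q q' hq hq' =>
    rw [sub_eq_iff_eq_add] at hq hq'
    simp only [coeffDeriv_mul h.mul, mul_add, add_mul, m, hq, hq', πA.leibniz, map_add, pderiv_mul',
      map_mul, mul_sub, mul_assoc]
    abel

/-- Partial derivatives of a bracket with an element of `R`. -/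
theorem pderiv_br (hf : ∀ a b, polyC k R (πR.br a b) = πA.br (polyC k R a) (polyC k R b))
    (m : Fin 2) (a : R) (q : MvPolynomial (Fin 2) R) :
    pderiv m (πA.br (polyC k R a) q) = πA.br (polyC k R a) (pderiv m q) +
      pderiv 0 q * pderiv m (πA.br (polyC k R a) (X 0)) +
      pderiv 1 q * pderiv m (πA.br (polyC k R a) (X 1)) := by
  have h1 : ∀ p, πA.br p 1 = 0 := πA.br_one
  induction q using poly_induction with
  | hC b => rw [← polyC_apply (k := k), ← hf, pderiv_polyC, pderiv_polyC, pderiv_polyC, pderiv_polyC]; simp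
  | hX r =>
    rw [pderiv_X, pderiv_X, pderiv_X]
    fin_cases r <;> fin_cases m <;> simp [h1]
  | hadd q q' hq hq' =>
    simp only [map_add, hq, hq']
    ring
  | hmul q q' hq hq' =>
    simp only [πA.leibniz, map_add, pderiv_mul', hq, hq']
    ring

end Commutators

end PolynomialDerivation

/-! ### The crossing rules as a homomorphism into 3 × 3 matrices -/

section CrossingHom

theorem optionMat_ext {V : Type*} {M N : Matrix (Option (Fin 2)) (Option (Fin 2)) V}
    (hs : ∀ r l, M (some r) (some l) = N (some r) (some l))
    (ht : ∀ r, M (some r) none = N (some r) none) (h0 : ∀ l, M none (some l) = N none (some l))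
    (hb : M none none = N none none) : M = N := by
  ext i j
  rcases i with _ | i <;> rcases j with _ | j
  · exact hb
  · exact h0 j
  · exact ht i
  · exact hs i j

open MvPolynomial

variable {k R U : Type*} [CommRing k] [CommRing R] [Algebra k R] [Ring U] [Algebra k U]

/-- The block matrix `(s, t; 0, b)`. -/
def crossMat (s : Fin 2 → Fin 2 → U) (t : Fin 2 → U) (b : U) :
    Matrix (Option (Fin 2)) (Option (Fin 2)) U :=
  Matrix.of fun i j => match i, j with
    | some r, some l => s r l
    | some r, none => t r
    | none, some _ => 0
    | none, none => b

@[simp] theorem crossMat_some_some (s : Fin 2 → Fin 2 → U) (t : Fin 2 → U) (b : U) (r l : Fin 2) :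
    crossMat s t b (some r) (some l) = s r l := rfl

@[simp] theorem crossMat_some_none (s : Fin 2 → Fin 2 → U) (t : Fin 2 → U) (b : U) (r : Fin 2) :
    crossMat s t b (some r) none = t r := rfl

@[simp] theorem crossMat_none_some (s : Fin 2 → Fin 2 → U) (t : Fin 2 → U) (b : U) (l : Fin 2) :
    crossMat s t b none (some l) = 0 := rfl

@[simp] theorem crossMat_none_none (s : Fin 2 → Fin 2 → U) (t : Fin 2 → U) (b : U) :
    crossMat s t b none none = b := rfl

theorem optionMat_mul_apply (M N : Matrix (Option (Fin 2)) (Option (Fin 2)) U)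
    (i j : Option (Fin 2)) : (M * N) i j =
      M i none * N none j + (M i (some 0) * N (some 0) j + M i (some 1) * N (some 1) j) := by
  rw [Matrix.mul_apply, Fintype.sum_option, Fin.sum_univ_two]

variable (πA : PoissonBracket k (MvPolynomial (Fin 2) R)) (g : MvPolynomial (Fin 2) R →ₐ[k] U)
  (d : R →ₗ[k] U)

/-- The matrix by which `p ∈ A` moves past `(y₁, y₂, 1)`. -/
noncomputable def crossAlg :
    MvPolynomial (Fin 2) R →ₐ[k] Matrix (Option (Fin 2)) (Option (Fin 2)) U :=
  AlgHom.ofLinearMap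
    { toFun := fun p => crossMat (fun r l => if r = l then g p else 0)
        (fun r => g (πA.br (X r) p)) (g p)
      map_add' := fun p q => optionMat_ext
        (fun r l => by
          simp only [Matrix.add_apply, crossMat_some_some, map_add]
          split_ifs <;> simp)
        (fun r => by simp) (fun l => by simp) (by simp)
      map_smul' := fun c p => optionMat_ext
        (fun r l => by
          simp only [Matrix.smul_apply, crossMat_some_some, map_smul, RingHom.id_apply]
          split_ifs <;> simp)
        (fun r => by simp) (fun l => by simp) (by simp) }
    (optionMat_ext
      (fun r l => by simp [Matrix.one_apply])
      (fun r => by simp [πA.br_one])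
      (fun l => by simp) (by simp))
    (fun p q => optionMat_ext
      (fun r l => by
        rw [optionMat_mul_apply]
        fin_cases r <;> fin_cases l <;> simp)
      (fun r => by
        have h : g (πA.br (X r) (p * q)) = g p * g (πA.br (X r) q) + g (πA.br (X r) p) * g q := by
          rw [← map_mul, ← map_mul, ← map_add, πA.leibniz, mul_comm q]
        rw [optionMat_mul_apply]
        fin_cases r
        · refine h.trans ?_
          simp [add_comm]
        · refine h.trans ?_
          simp [add_comm])
      (fun l => by rw [optionMat_mul_apply]; simp)
      (by rw [optionMat_mul_apply]; simp))

theorem crossAlg_apply (p : MvPolynomial (Fin 2) R) : crossAlg πA g p =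
    crossMat (fun r l => if r = l then g p else 0) (fun r => g (πA.br (X r) p)) (g p) := rfl

/-- The matrix by which `da`, `a ∈ R`, moves past `(y₁, y₂, 1)`. -/
noncomputable def crossDer : R →ₗ[k] Matrix (Option (Fin 2)) (Option (Fin 2)) U where
  toFun a := crossMat (fun r l => (if r = l then d a else 0) +
      g (pderiv l (πA.br (X r) (polyC k R a))))
    (fun r => coeffDeriv g d (πA.br (X r) (polyC k R a))) (d a)
  map_add' a b := optionMat_ext
    (fun r l => by
      simp only [Matrix.add_apply, crossMat_some_some, map_add]
      split_ifs <;> abel)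
    (fun r => by simp) (fun l => by simp) (by simp)
  map_smul' c a := optionMat_ext
    (fun r l => by
      have h : ∀ p : MvPolynomial (Fin 2) R, pderiv l (c • p) = c • pderiv l p :=
        ((pderiv l).toLinearMap.restrictScalars k).map_smul c
      simp only [Matrix.smul_apply, crossMat_some_some, map_smul, RingHom.id_apply, h]
      split_ifs <;> simp)
    (fun r => by simp) (fun l => by simp) (by simp)

theorem crossDer_apply (a : R) : crossDer πA g d a =
    crossMat (fun r l => (if r = l then d a else 0) +
      g (pderiv l (πA.br (X r) (polyC k R a))))
    (fun r => coeffDeriv g d (πA.br (X r) (polyC k R a))) (d a) := rfl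

variable {πA g d} {πR : PoissonBracket k R}

theorem sum_ite_mul (r : Fin 2) (u : U) (m v : Fin 2 → U) :
    ((if r = 0 then u else 0) + m 0) * v 0 + ((if r = 1 then u else 0) + m 1) * v 1 =
      u * v r + (m 0 * v 0 + m 1 * v 1) := by
  fin_cases r
  · simp [add_mul, add_assoc]
  · simp only [Fin.mk_one, one_ne_zero, if_false, if_true, add_mul, zero_mul]
    abel

/-- Entry by entry, the first two relations are the Jacobi identity with a variable `x_r` in the
first slot, and the third is the Leibniz rule for `{x_r, -}`. The `σ`-entries arise by applying
`∂_l`, the last column by extracting the part of a differential without `dx₁, dx₂`. -/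
theorem satisfiesRelP_cross
    (hf : ∀ a b, polyC k R (πR.br a b) = πA.br (polyC k R a) (polyC k R b))
    (h : SatisfiesRelP πR πA (polyC k R) g d) :
    SatisfiesRelP πR πA (polyC k R) (crossAlg πA g) (crossDer πA g d) where
  lie a b := by
    have hJ : ∀ r : Fin 2, πA.br (X r) (πA.br (polyC k R a) (polyC k R b)) =
        πA.br (polyC k R a) (πA.br (X r) (polyC k R b)) -
        πA.br (polyC k R b) (πA.br (X r) (polyC k R a)) := by
      intro r
      rw [πA.br_br (X r), πA.br_skew (πA.br (X r) (polyC k R a))]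
      ring
    refine optionMat_ext (fun r l => ?_) (fun r => ?_) (fun l => ?_) ?_
    · rw [Matrix.sub_apply, optionMat_mul_apply, optionMat_mul_apply]
      simp only [crossDer_apply, crossMat_some_some, crossMat_some_none, crossMat_none_some,
        mul_zero, zero_add]
      rw [sum_ite_mul r (d a) (fun l => g (pderiv l (πA.br (X r) (polyC k R a))))
          (fun r => (if r = l then d b else 0) + g (pderiv l (πA.br (X r) (polyC k R b)))),
        sum_ite_mul r (d b) (fun l => g (pderiv l (πA.br (X r) (polyC k R b))))
          (fun r => (if r = l then d a else 0) + g (pderiv l (πA.br (X r) (polyC k R a))))]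
      -- The partial derivative of the Jacobi identity: by `pderiv_br`, differentiating `{a, -}`
      -- yields a commutator with `da` and products of first derivatives, which are the products of
      -- matrix entries.
      have e : g (pderiv l (πA.br (X r) (polyC k R (πR.br a b)))) =
          (d a * g (pderiv l (πA.br (X r) (polyC k R b))) -
            g (pderiv l (πA.br (X r) (polyC k R b))) * d a) -
          (d b * g (pderiv l (πA.br (X r) (polyC k R a))) -
            g (pderiv l (πA.br (X r) (polyC k R a))) * d b) +
          (g (pderiv 0 (πA.br (X r) (polyC k R a))) * g (pderiv l (πA.br (X 0) (polyC k R b))) +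
            g (pderiv 1 (πA.br (X r) (polyC k R a))) * g (pderiv l (πA.br (X 1) (polyC k R b)))) -
          (g (pderiv 0 (πA.br (X r) (polyC k R b))) * g (pderiv l (πA.br (X 0) (polyC k R a))) +
            g (pderiv 1 (πA.br (X r) (polyC k R b))) * g (pderiv l (πA.br (X 1) (polyC k R a)))) := by
        rw [hf, hJ, map_sub, pderiv_br hf l a (πA.br (X r) (polyC k R b)),
          pderiv_br hf l b (πA.br (X r) (polyC k R a))]
        simp only [πA.br_skew _ (X _), map_neg, mul_neg, map_sub, map_add, map_mul, h.bracket]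
        abel
      rw [e, h.lie]
      fin_cases r <;> fin_cases l <;> simp [mul_add] <;> abel
    · rw [Matrix.sub_apply, optionMat_mul_apply, optionMat_mul_apply]
      simp only [crossDer_apply, crossMat_some_some, crossMat_some_none, crossMat_none_none]
      rw [sum_ite_mul r (d a) (fun l => g (pderiv l (πA.br (X r) (polyC k R a))))
          (fun r => coeffDeriv g d (πA.br (X r) (polyC k R b))),
        sum_ite_mul r (d b) (fun l => g (pderiv l (πA.br (X r) (polyC k R b))))
          (fun r => coeffDeriv g d (πA.br (X r) (polyC k R a)))]
      -- The same Jacobi identity under `coeffDeriv`: commutators of `da` and `db` with the last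
      -- columns produce its terms.
      have e1 := coeffDeriv_comm_right hf h a (πA.br (X r) (polyC k R b))
      have e2 := coeffDeriv_comm_right hf h b (πA.br (X r) (polyC k R a))
      simp only [πA.br_skew _ (X _), map_neg, mul_neg, sub_neg_eq_add] at e1 e2
      rw [hf, hJ, map_sub]
      linear_combination (norm := abel) e2 - e1
    · rw [Matrix.sub_apply, optionMat_mul_apply, optionMat_mul_apply]
      simp [crossDer_apply]
    · rw [Matrix.sub_apply, optionMat_mul_apply, optionMat_mul_apply]
      simp [crossDer_apply, h.lie]
  bracket a p := by
    refine optionMat_ext (fun r l => ?_) (fun r => ?_) (fun l => ?_) ?_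
    · rw [Matrix.sub_apply, optionMat_mul_apply, optionMat_mul_apply]
      have hc : ∀ q, g q * g p = g p * g q := by
        intro q
        rw [← map_mul, mul_comm, map_mul]
      fin_cases r <;> fin_cases l <;>
        simp [crossDer_apply, crossAlg_apply, h.bracket, add_mul, mul_add, hc]
    · rw [Matrix.sub_apply, optionMat_mul_apply, optionMat_mul_apply]
      simp only [crossDer_apply, crossAlg_apply, crossMat_some_some, crossMat_some_none,
        crossMat_none_none]
      rw [sum_ite_mul r (d a) (fun l => g (pderiv l (πA.br (X r) (polyC k R a))))
          (fun r => g (πA.br (X r) p))]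
      -- The terms with `∂_l {x_r, a}` on the right of this identity are the off-diagonal
      -- contributions to the matrix product.
      have e1 := coeffDeriv_comm_left h (πA.br (X r) (polyC k R a)) p
      have e2 := h.bracket a (πA.br (X r) p)
      have e3 : ((if r = 0 then g p else 0) * coeffDeriv g d (πA.br (X 0) (polyC k R a)) +
          (if r = 1 then g p else 0) * coeffDeriv g d (πA.br (X 1) (polyC k R a))) =
          g p * coeffDeriv g d (πA.br (X r) (polyC k R a)) := by
        fin_cases r <;> simp
      simp only [map_sub, map_mul] at e1
      rw [e3, πA.br_br (X r), map_add]
      linear_combination (norm := abel) e2 - e1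
    · rw [Matrix.sub_apply, optionMat_mul_apply, optionMat_mul_apply]
      simp [crossDer_apply, crossAlg_apply]
    · rw [Matrix.sub_apply, optionMat_mul_apply, optionMat_mul_apply]
      simp [crossDer_apply, crossAlg_apply, h.bracket]
  mul a b := by
    refine optionMat_ext (fun r l => ?_) (fun r => ?_) (fun l => ?_) ?_
    · rw [Matrix.add_apply, optionMat_mul_apply, optionMat_mul_apply]
      have e := congrArg g (congrArg (pderiv l) (πA.leibniz (X r) (polyC k R a) (polyC k R b)))
      simp only [map_add, pderiv_mul', pderiv_polyC, mul_zero, add_zero, map_mul] at e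
      fin_cases r <;> fin_cases l <;>
        simp_all [crossDer_apply, crossAlg_apply, h.mul, mul_add] <;> abel
    · rw [Matrix.add_apply, optionMat_mul_apply, optionMat_mul_apply]
      have e := congrArg (coeffDeriv g d) (πA.leibniz (X r) (polyC k R a) (polyC k R b))
      simp only [map_add, coeffDeriv_mul h.mul, coeffDeriv_polyC] at e
      fin_cases r <;> simp_all [crossDer_apply, crossAlg_apply] <;> abel
    · rw [Matrix.add_apply, optionMat_mul_apply, optionMat_mul_apply]
      simp [crossDer_apply, crossAlg_apply]
    · rw [Matrix.add_apply, optionMat_mul_apply, optionMat_mul_apply]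
      simp [crossDer_apply, crossAlg_apply, h.mul]

end CrossingHom

/-! ### The defect of the Lie relation -/

section LieDefect

open MvPolynomial

variable {k R U : Type*} [CommRing k] [CommRing R] [Algebra k R] [Ring U] [Algebra k U]
  {π : PoissonBracket k (MvPolynomial (Fin 2) R)} {γ : MvPolynomial (Fin 2) R →ₐ[k] U}
  {δ : MvPolynomial (Fin 2) R →ₗ[k] U}

/-- Both sides are derivations in `p`; for the commutator this uses that the image of `γ` is
commutative. -/
theorem bracket_of_generators (hmul : ∀ p q, δ (p * q) = γ p * δ q + γ q * δ p)
    (hC : ∀ a q, γ (π.br (polyC k R a) q) = δ (polyC k R a) * γ q - γ q * δ (polyC k R a))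
    (hX : ∀ r q, γ (π.br (X r) q) = δ (X r) * γ q - γ q * δ (X r))
    (p q : MvPolynomial (Fin 2) R) : γ (π.br p q) = δ p * γ q - γ q * δ p := by
  induction p using poly_induction with
  | hC a => exact hC a q
  | hX r => exact hX r q
  | hadd p p' hp hp' =>
    rw [map_add, map_add, LinearMap.add_apply, map_add, hp, hp']
    noncomm_ring
  | hmul p p' hp hp' =>
    have c1 : γ q * γ p = γ p * γ q := by rw [← map_mul, mul_comm, map_mul]
    have c2 : γ q * γ p' = γ p' * γ q := by rw [← map_mul, mul_comm, map_mul]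
    rw [π.br_mul_left, map_add, map_mul, map_mul, hp, hp', hmul, mul_add, ← mul_assoc (γ q),
      ← mul_assoc (γ q), c1, c2]
    noncomm_ring

variable (π δ) in
/-- The failure of `δ` to be a homomorphism of Lie algebras. -/
noncomputable def lieDefect (p q : MvPolynomial (Fin 2) R) : U := δ p * δ q - δ q * δ p - δ (π.br p q)

theorem lieDefect_skew (p q : MvPolynomial (Fin 2) R) :
    lieDefect π δ q p = -lieDefect π δ p q := by
  rw [lieDefect, lieDefect, π.br_skew q p, map_neg]
  abel

theorem lieDefect_add_right (p q q' : MvPolynomial (Fin 2) R) :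
    lieDefect π δ p (q + q') = lieDefect π δ p q + lieDefect π δ p q' := by
  simp only [lieDefect, map_add, mul_add, add_mul]
  abel

/-- The extra terms `γ{p, q} δq'` and `γ{p, q'} δq` occur once in the commutator and once in `δ{p, q
q'}`, so they cancel. -/
theorem lieDefect_mul_right (hmul : ∀ p q, δ (p * q) = γ p * δ q + γ q * δ p)
    (hb : ∀ p q, γ (π.br p q) = δ p * γ q - γ q * δ p) (p q q' : MvPolynomial (Fin 2) R) :
    lieDefect π δ p (q * q') = γ q * lieDefect π δ p q' + γ q' * lieDefect π δ p q := by
  simp only [lieDefect, hmul, π.leibniz, map_add, hb]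
  noncomm_ring

/-- By Jacobi, `[δp, δq]` and `δ{p, q}` have the same commutator with `γ r`, namely `γ{{p, q}, r}`.
-/
theorem lieDefect_comm (hb : ∀ p q, γ (π.br p q) = δ p * γ q - γ q * δ p)
    (p q r : MvPolynomial (Fin 2) R) : lieDefect π δ p q * γ r = γ r * lieDefect π δ p q := by
  have h1 := hb p (π.br q r)
  have h2 := hb q (π.br p r)
  have h3 := hb (π.br p q) r
  rw [π.br_br p, map_add, h3, h2, hb p r, hb q r] at h1
  rw [← sub_eq_zero] at h1 ⊢
  rw [← neg_eq_zero, ← h1, lieDefect]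
  noncomm_ring

theorem lieDefect_polyC (hmul : ∀ p q, δ (p * q) = γ p * δ q + γ q * δ p)
    (hb : ∀ p q, γ (π.br p q) = δ p * γ q - γ q * δ p)
    (hCC : ∀ a b, lieDefect π δ (polyC k R a) (polyC k R b) = 0)
    (hXC : ∀ r a, lieDefect π δ (X r) (polyC k R a) = 0) (a : R) (q : MvPolynomial (Fin 2) R) :
    lieDefect π δ (polyC k R a) q = 0 := by
  induction q using poly_induction with
  | hC b => exact hCC a b
  | hX r => rw [lieDefect_skew, hXC, neg_zero]
  | hadd q q' hq hq' => rw [lieDefect_add_right, hq, hq', add_zero]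
  | hmul q q' hq hq' => rw [lieDefect_mul_right hmul hb, hq, hq', mul_zero, mul_zero, add_zero]

/-- The defect is a derivation in `q` that vanishes on `R`, hence is given by the chain rule. -/
theorem lieDefect_X (hmul : ∀ p q, δ (p * q) = γ p * δ q + γ q * δ p)
    (hb : ∀ p q, γ (π.br p q) = δ p * γ q - γ q * δ p)
    (hXC : ∀ r a, lieDefect π δ (X r) (polyC k R a) = 0) (r : Fin 2)
    (q : MvPolynomial (Fin 2) R) :
    lieDefect π δ (X r) q = γ (pderiv 0 q) * lieDefect π δ (X r) (X 0) +
      γ (pderiv 1 q) * lieDefect π δ (X r) (X 1) := by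
  induction q using poly_induction with
  | hC b =>
    rw [← polyC_apply (k := k), hXC, pderiv_polyC, pderiv_polyC]
    simp
  | hX l =>
    rw [pderiv_X, pderiv_X]
    fin_cases l <;> simp
  | hadd q q' hq hq' =>
    rw [lieDefect_add_right, hq, hq']
    simp only [map_add, add_mul]
    abel
  | hmul q q' hq hq' =>
    rw [lieDefect_mul_right hmul hb, hq, hq']
    simp only [pderiv_mul', map_add, map_mul, add_mul, mul_add, mul_assoc]
    abel

theorem lieDefect_self (p : MvPolynomial (Fin 2) R) : lieDefect π δ p p = 0 := by
  rw [lieDefect, π.br_self, map_zero]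
  abel

/-- The Lie defect of the two variables commutes with `da`, `a ∈ R`, up to a factor. -/
theorem lieDefect_X_X_mul (hmul : ∀ p q, δ (p * q) = γ p * δ q + γ q * δ p)
    (hb : ∀ p q, γ (π.br p q) = δ p * γ q - γ q * δ p)
    (hCC : ∀ a b, lieDefect π δ (polyC k R a) (polyC k R b) = 0)
    (hXC : ∀ r a, lieDefect π δ (X r) (polyC k R a) = 0) (a : R) :
    lieDefect π δ (X 1) (X 0) * δ (polyC k R a) =
      (δ (polyC k R a) + γ (pderiv 0 (π.br (X 0) (polyC k R a)) +
        pderiv 1 (π.br (X 1) (polyC k R a)))) * lieDefect π δ (X 1) (X 0) := by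
  -- Comparing the Jacobi identities for commutators and for the bracket on `x₂, x₁, a` gives `[Ω,
  -- δa]` as the defect of `(x₂, {x₁, a})` minus that of `(x₁, {x₂, a})`. Each is a multiple of `Ω`
  -- by the chain rule, the other variable contributing zero by skewness.
  have e1 : lieDefect π δ (X 1) (π.br (X 0) (polyC k R a)) =
      γ (pderiv 0 (π.br (X 0) (polyC k R a))) * lieDefect π δ (X 1) (X 0) := by
    rw [lieDefect_X hmul hb hXC, lieDefect_self, mul_zero, add_zero]
  have e0 : lieDefect π δ (X 0) (π.br (X 1) (polyC k R a)) =
      -(γ (pderiv 1 (π.br (X 1) (polyC k R a))) * lieDefect π δ (X 1) (X 0)) := by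
    rw [lieDefect_X hmul hb hXC, lieDefect_self, mul_zero, zero_add, lieDefect_skew (X 1), mul_neg]
  have ef : lieDefect π δ (π.br (X 1) (X 0)) (polyC k R a) = 0 := by
    rw [lieDefect_skew, lieDefect_polyC hmul hb hCC hXC, neg_zero]
  have d0 := hXC 0 a
  have d1 := hXC 1 a
  have hJ := congrArg δ (π.br_br (X 1) (X 0) (polyC k R a))
  rw [map_add] at hJ
  rw [map_add, add_mul, add_mul, ← e1, ← neg_eq_iff_eq_neg.mpr e0]
  simp only [lieDefect] at d0 d1 ef ⊢
  rw [sub_eq_zero] at d0 d1 ef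
  rw [hJ, ← d0, ← d1, ← ef]
  noncomm_ring

/-- The defect is a skew biderivation, so the Lie relation needs checking on pairs of generators
only. -/
theorem satisfiesP_of_generators (hmul : ∀ p q, δ (p * q) = γ p * δ q + γ q * δ p)
    (hb : ∀ p q, γ (π.br p q) = δ p * γ q - γ q * δ p)
    (hCC : ∀ a b, lieDefect π δ (polyC k R a) (polyC k R b) = 0)
    (hXC : ∀ r a, lieDefect π δ (X r) (polyC k R a) = 0)
    (hXX : lieDefect π δ (X 1) (X 0) = 0) : SatisfiesP π γ δ where
  bracket := hb
  mul := hmul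
  lie p q := by
    suffices h : lieDefect π δ p q = 0 by
      rw [lieDefect, sub_eq_zero] at h
      exact h.symm
    have hX : ∀ r q, lieDefect π δ (X r) q = 0 := by
      intro r q
      rw [lieDefect_X hmul hb hXC]
      fin_cases r
      · simp [lieDefect_self, lieDefect_skew (X 1) (X 0), hXX]
      · simp [lieDefect_self, hXX]
    rw [lieDefect_skew, neg_eq_zero]
    induction p using poly_induction with
    | hC a => rw [lieDefect_skew, ← polyC_apply (k := k), lieDefect_polyC hmul hb hCC hXC, neg_zero]
    | hX r => rw [lieDefect_skew, hX, neg_zero]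
    | hadd p p' hp hp' => rw [lieDefect_add_right, hp, hp', add_zero]
    | hmul p p' hp hp' => rw [lieDefect_mul_right hmul hb, hp, hp', mul_zero, mul_zero, add_zero]

end LieDefect

/-! ### `A^e` as a left double extension of the relative algebra -/

section EnvOverRelEnv

open MvPolynomial RelPoissonEnv

variable {k R : Type*} [CommRing k] [CommRing R] [Algebra k R]
  {πR : PoissonBracket k R} {πA : PoissonBracket k (MvPolynomial (Fin 2) R)}
  (hf : ∀ a b, polyC k R (πR.br a b) = πA.br (polyC k R a) (polyC k R b))

/-- The homomorphism `u ↦ (σ(u), δ(u); 0, u)` on the relative enveloping algebra. -/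
noncomputable def crossHom : RelPoissonEnv πR πA (polyC k R) →ₐ[k]
    Matrix (Option (Fin 2)) (Option (Fin 2)) (RelPoissonEnv πR πA (polyC k R)) :=
  RelPoissonEnv.lift _ _ (satisfiesRelP_cross hf (satisfiesRelP πR πA (polyC k R)))

theorem crossHom_i (p : MvPolynomial (Fin 2) R) :
    crossHom hf (RelPoissonEnv.i πR πA _ p) = crossAlg πA (RelPoissonEnv.i πR πA _) p :=
  RelPoissonEnv.lift_i _ _ _ _

theorem crossHom_d (a : R) : crossHom hf (RelPoissonEnv.d πR πA _ a) =
    crossDer πA (RelPoissonEnv.i πR πA _) (RelPoissonEnv.d πR πA _) a :=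
  RelPoissonEnv.lift_d _ _ _ _

theorem crossHom_none (u : RelPoissonEnv πR πA (polyC k R)) :
    (∀ l, crossHom hf u none (some l) = 0) ∧ crossHom hf u none none = u := by
  induction u using RelPoissonEnv.induction with
  | hi p => rw [crossHom_i]; exact ⟨fun _ => rfl, rfl⟩
  | hd a => rw [crossHom_d]; exact ⟨fun _ => rfl, rfl⟩
  | hadd u v hu hv => simp [hu, hv]
  | hmul u v hu hv => simp [optionMat_mul_apply, hu, hv]

/-- The maps `σ` moving `y₁`, `y₂` past the elements of the relative enveloping algebra. -/
noncomputable def crossσ (r l : Fin 2) :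
    RelPoissonEnv πR πA (polyC k R) →ₗ[k] RelPoissonEnv πR πA (polyC k R) :=
  (Matrix.entryLinearMap k _ (some r) (some l)).comp (crossHom hf).toLinearMap

/-- The maps `δ` moving `y₁`, `y₂` past the elements of the relative enveloping algebra. -/
noncomputable def crossδ (r : Fin 2) :
    RelPoissonEnv πR πA (polyC k R) →ₗ[k] RelPoissonEnv πR πA (polyC k R) :=
  (Matrix.entryLinearMap k _ (some r) none).comp (crossHom hf).toLinearMap

theorem crossσ_apply (r l : Fin 2) (u : RelPoissonEnv πR πA (polyC k R)) :
    crossσ hf r l u = crossHom hf u (some r) (some l) := rfl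

theorem crossδ_apply (r : Fin 2) (u : RelPoissonEnv πR πA (polyC k R)) :
    crossδ hf r u = crossHom hf u (some r) none := rfl

/-- Multiplicativity of `crossHom`, with the bottom row of each matrix known from `crossHom_none`.
-/
theorem isCrossing_cross : IsCrossing (crossσ hf) (crossδ hf) where
  σ_one r l := by simp [crossσ_apply, Matrix.one_apply]
  δ_one r := by simp [crossδ_apply]
  σ_mul r l u v := by simp [crossσ_apply, optionMat_mul_apply, crossHom_none]
  δ_mul r u v := by
    simp only [crossσ_apply, crossδ_apply, map_mul, optionMat_mul_apply, crossHom_none]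
    abel

theorem crossσ_i (r l : Fin 2) (p : MvPolynomial (Fin 2) R) :
    crossσ hf r l (RelPoissonEnv.i πR πA _ p) =
      if r = l then RelPoissonEnv.i πR πA _ p else 0 := by
  rw [crossσ_apply, crossHom_i]; rfl

theorem crossδ_i (r : Fin 2) (p : MvPolynomial (Fin 2) R) :
    crossδ hf r (RelPoissonEnv.i πR πA _ p) = RelPoissonEnv.i πR πA _ (πA.br (X r) p) := by
  rw [crossδ_apply, crossHom_i]; rfl

theorem crossσ_d (r l : Fin 2) (a : R) : crossσ hf r l (RelPoissonEnv.d πR πA _ a) =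
    (if r = l then RelPoissonEnv.d πR πA _ a else 0) +
      RelPoissonEnv.i πR πA _ (pderiv l (πA.br (X r) (polyC k R a))) := by
  rw [crossσ_apply, crossHom_d]; rfl

/-- The coefficientwise extension of `d` from `R` to `A`, with values in the relative enveloping
algebra. -/
noncomputable def relCoeffDeriv (πR : PoissonBracket k R)
    (πA : PoissonBracket k (MvPolynomial (Fin 2) R)) :
    MvPolynomial (Fin 2) R →ₗ[k] RelPoissonEnv πR πA (polyC k R) :=
  coeffDeriv (RelPoissonEnv.i πR πA _) (RelPoissonEnv.d πR πA _)

theorem crossδ_d (r : Fin 2) (a : R) : crossδ hf r (RelPoissonEnv.d πR πA _ a) =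
    relCoeffDeriv πR πA (πA.br (X r) (polyC k R a)) := by
  rw [crossδ_apply, crossHom_d]; rfl

/-- The differential of a polynomial, in any algebra containing the relative enveloping
algebra. -/
theorem derivation_eq {U : Type*} [Ring U] [Algebra k U]
    (φ : RelPoissonEnv πR πA (polyC k R) →ₐ[k] U) (D : MvPolynomial (Fin 2) R →ₗ[k] U)
    (hmul : ∀ p q, D (p * q) = φ (RelPoissonEnv.i πR πA _ p) * D q +
      φ (RelPoissonEnv.i πR πA _ q) * D p)
    (hC : ∀ a, D (polyC k R a) = φ (RelPoissonEnv.d πR πA _ a)) (p : MvPolynomial (Fin 2) R) :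
    D p = φ (RelPoissonEnv.i πR πA _ (pderiv 0 p)) * D (X 0) +
      φ (RelPoissonEnv.i πR πA _ (pderiv 1 p)) * D (X 1) + φ (relCoeffDeriv πR πA p) := by
  have hd := (satisfiesRelP πR πA (polyC k R)).mul
  induction p using poly_induction with
  | hC a =>
    rw [← polyC_apply (k := k), hC, pderiv_polyC, pderiv_polyC, relCoeffDeriv, coeffDeriv_polyC]
    simp
  | hX r =>
    rw [relCoeffDeriv, coeffDeriv_X hd, pderiv_X, pderiv_X]
    fin_cases r <;> simp
  | hadd p q hp hq =>
    rw [map_add, hp, hq]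
    simp only [map_add, add_mul]
    abel
  | hmul p q hp hq =>
    rw [hmul, hp, hq, relCoeffDeriv, coeffDeriv_mul hd]
    simp only [pderiv_mul', map_add, map_mul, mul_add, add_mul, mul_assoc]
    abel

theorem toEnv_i (p : MvPolynomial (Fin 2) R) :
    toEnv hf (RelPoissonEnv.i πR πA _ p) = PoissonEnv.i πA p := by
  simp [toEnv]

theorem toEnv_d (a : R) :
    toEnv hf (RelPoissonEnv.d πR πA _ a) = PoissonEnv.d πA (polyC k R a) := by
  simp [toEnv]

/-- The variables `y₁ = dx₁`, `y₂ = dx₂`. -/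
noncomputable def dVar (πA : PoissonBracket k (MvPolynomial (Fin 2) R)) (r : Fin 2) :
    PoissonEnv πA :=
  PoissonEnv.d πA (X r)

section Lift

variable {U : Type*} [Ring U] [Algebra k U] {φ : RelPoissonEnv πR πA (polyC k R) →ₐ[k] U}
  {y : Fin 2 → U}

/-- The candidate for the differential `A → U` when `y₁`, `y₂` are the differentials of the
variables. -/
noncomputable def liftDer (φ : RelPoissonEnv πR πA (polyC k R) →ₐ[k] U) (y : Fin 2 → U) :
    MvPolynomial (Fin 2) R →ₗ[k] U :=
  derivExt (φ.comp (RelPoissonEnv.i πR πA _)) (φ.toLinearMap.comp (RelPoissonEnv.d πR πA _)) y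

theorem liftDer_polyC (a : R) : liftDer φ y (polyC k R a) = φ (RelPoissonEnv.d πR πA _ a) :=
  derivExt_polyC _ _

theorem comp_d_mul (a b : R) :
    (φ.toLinearMap.comp (RelPoissonEnv.d πR πA _)) (a * b) =
      φ.comp (RelPoissonEnv.i πR πA _) (polyC k R a) *
        (φ.toLinearMap.comp (RelPoissonEnv.d πR πA _)) b +
      φ.comp (RelPoissonEnv.i πR πA _) (polyC k R b) *
        (φ.toLinearMap.comp (RelPoissonEnv.d πR πA _)) a := by
  simp [(satisfiesRelP πR πA (polyC k R)).mul]

theorem liftDer_X (r : Fin 2) : liftDer φ y (X r) = y r :=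
  derivExt_X _ comp_d_mul r

theorem liftDer_mul (p q : MvPolynomial (Fin 2) R) : liftDer φ y (p * q) =
    φ.comp (RelPoissonEnv.i πR πA _) p * liftDer φ y q +
      φ.comp (RelPoissonEnv.i πR πA _) q * liftDer φ y p :=
  derivExt_mul _ comp_d_mul p q

theorem liftDer_eq (p : MvPolynomial (Fin 2) R) : liftDer φ y p =
    φ (RelPoissonEnv.i πR πA _ (pderiv 0 p)) * y 0 +
      φ (RelPoissonEnv.i πR πA _ (pderiv 1 p)) * y 1 + φ (relCoeffDeriv πR πA p) := by
  have h := derivation_eq φ (liftDer φ y) liftDer_mul liftDer_polyC p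
  rwa [liftDer_X, liftDer_X] at h

theorem liftDer_bracket
    (hy : ∀ r u, y r * φ u = φ (crossσ hf r 0 u) * y 0 + φ (crossσ hf r 1 u) * y 1 +
      φ (crossδ hf r u)) (p q : MvPolynomial (Fin 2) R) :
    φ.comp (RelPoissonEnv.i πR πA _) (πA.br p q) =
      liftDer φ y p * φ.comp (RelPoissonEnv.i πR πA _) q -
        φ.comp (RelPoissonEnv.i πR πA _) q * liftDer φ y p := by
  refine bracket_of_generators (δ := liftDer φ y) liftDer_mul (fun a q => ?_) (fun r q => ?_) p q
  · rw [liftDer_polyC]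
    simp [(satisfiesRelP πR πA (polyC k R)).bracket]
  · rw [liftDer_X, AlgHom.comp_apply, AlgHom.comp_apply, hy, crossσ_i, crossσ_i, crossδ_i]
    fin_cases r <;> simp

theorem lieDefect_liftDer_polyC
    (hf : ∀ a b, polyC k R (πR.br a b) = πA.br (polyC k R a) (polyC k R b)) (a b : R) :
    lieDefect πA (liftDer φ y) (polyC k R a) (polyC k R b) = 0 := by
  rw [lieDefect, ← hf, liftDer_polyC, liftDer_polyC, liftDer_polyC,
    (satisfiesRelP πR πA (polyC k R)).lie]
  simp

/-- The values of `σ` and `δ` at `da` were chosen as the components of `d{x_r, a}`, so the crossing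
rule for `da` is the Lie relation. -/
theorem lieDefect_liftDer_X_polyC
    (hy : ∀ r u, y r * φ u = φ (crossσ hf r 0 u) * y 0 + φ (crossσ hf r 1 u) * y 1 +
      φ (crossδ hf r u)) (r : Fin 2) (a : R) :
    lieDefect πA (liftDer φ y) (X r) (polyC k R a) = 0 := by
  rw [lieDefect, liftDer_eq (πA.br _ _), liftDer_polyC, liftDer_X, hy, crossσ_d, crossσ_d,
    crossδ_d]
  fin_cases r <;> simp [add_mul] <;> abel

theorem lieDefect_liftDer_X_X : lieDefect πA (liftDer φ y) (X 1) (X 0) = y 1 * y 0 - y 0 * y 1 -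
    (φ (RelPoissonEnv.i πR πA _ (pderiv 0 (πA.br (X 1) (X 0)))) * y 0 +
      φ (RelPoissonEnv.i πR πA _ (pderiv 1 (πA.br (X 1) (X 0)))) * y 1 +
      φ (relCoeffDeriv πR πA (πA.br (X 1) (X 0)))) := by
  rw [lieDefect, liftDer_eq (πA.br _ _), liftDer_X, liftDer_X]

/-- The defect of the quadratic relation moves past the image of the relative enveloping
algebra. -/
theorem exists_lieDefect_mul
    (hy : ∀ r u, y r * φ u = φ (crossσ hf r 0 u) * y 0 + φ (crossσ hf r 1 u) * y 1 +
      φ (crossδ hf r u)) (u : RelPoissonEnv πR πA (polyC k R)) :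
    ∃ v, lieDefect πA (liftDer φ y) (X 1) (X 0) * φ u =
      φ v * lieDefect πA (liftDer φ y) (X 1) (X 0) := by
  induction u using RelPoissonEnv.induction with
  | hi p => exact ⟨_, lieDefect_comm (liftDer_bracket hf hy) (X 1) (X 0) p⟩
  | hd a =>
    -- The witness is the factor in `lieDefect_X_X_mul`: `da` shifted by the trace of the matrix
    -- `∂_l {x_r, a}`.
    refine ⟨RelPoissonEnv.d πR πA _ a + RelPoissonEnv.i πR πA _
      (pderiv 0 (πA.br (X 0) (polyC k R a)) + pderiv 1 (πA.br (X 1) (polyC k R a))), ?_⟩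
    have := lieDefect_X_X_mul liftDer_mul (liftDer_bracket hf hy)
      (lieDefect_liftDer_polyC hf) (lieDefect_liftDer_X_polyC hf hy) a
    rw [liftDer_polyC] at this
    rw [map_add]
    exact this
  | hadd u v hu hv =>
    obtain ⟨u', hu⟩ := hu
    obtain ⟨v', hv⟩ := hv
    exact ⟨u' + v', by rw [map_add, mul_add, hu, hv, map_add, add_mul]⟩
  | hmul u v hu hv =>
    obtain ⟨u', hu⟩ := hu
    obtain ⟨v', hv⟩ := hv
    exact ⟨u' * v', by rw [map_mul, ← mul_assoc, hu, mul_assoc, hv, map_mul, mul_assoc]⟩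

/-- A homomorphism on the relative enveloping algebra extends to `A^e` if there are elements
`y₁`, `y₂` with the right commutation relations. -/
theorem exists_lift_toEnv
    (hy : ∀ r u, y r * φ u = φ (crossσ hf r 0 u) * y 0 + φ (crossσ hf r 1 u) * y 1 +
      φ (crossδ hf r u))
    (hD : lieDefect πA (liftDer φ y) (X 1) (X 0) = 0) :
    ∃ ρ : PoissonEnv πA →ₐ[k] U, (∀ u, ρ (toEnv hf u) = φ u) ∧ ∀ r, ρ (dVar πA r) = y r := by
  have hP := satisfiesP_of_generators liftDer_mul (liftDer_bracket hf hy)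
    (lieDefect_liftDer_polyC hf) (lieDefect_liftDer_X_polyC hf hy) hD
  refine ⟨PoissonEnv.lift _ _ hP, fun u => ?_, fun r => ?_⟩
  · induction u using RelPoissonEnv.induction with
    | hi p => rw [toEnv_i, PoissonEnv.lift_i]; rfl
    | hd a => rw [toEnv_d, PoissonEnv.lift_d, liftDer_polyC]
    | hadd u v hu hv => rw [map_add, map_add, map_add, hu, hv]
    | hmul u v hu hv => rw [map_mul, map_mul, map_mul, hu, hv]
  · rw [dVar, PoissonEnv.lift_d, liftDer_X]

end Lift

variable (πR πA) in
/-- Left multiplication on the free module over the relative enveloping algebra. -/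
noncomputable def relMulOp : RelPoissonEnv πR πA (polyC k R) →ₐ[k]
    Module.End k (ℕ × ℕ →₀ RelPoissonEnv πR πA (polyC k R)) :=
  Algebra.lsmul k k _

theorem relMulOp_apply (u : RelPoissonEnv πR πA (polyC k R))
    (v : ℕ × ℕ →₀ RelPoissonEnv πR πA (polyC k R)) : relMulOp πR πA u v = u • v := rfl

/-- The action of `A^e` on the free module over the relative enveloping algebra. -/
theorem exists_envRep : ∃ ρ : PoissonEnv πA →ₐ[k]
    Module.End k (ℕ × ℕ →₀ RelPoissonEnv πR πA (polyC k R)),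
    (∀ u v, ρ (toEnv hf u) v = u • v) ∧ ∀ m n,
      ρ (dVar πA 0 ^ m * dVar πA 1 ^ n) (Finsupp.single (0, 0) 1) = Finsupp.single (m, n) 1 := by
  have hc := isCrossing_cross hf
  -- The coefficients are those of `dx₁`, `dx₂` and `1` in `d{x₂, x₁}`, as `[dx₂, dx₁] = d{x₂, x₁}`
  -- demands.
  let τ₁ := RelPoissonEnv.i πR πA (polyC k R) (pderiv 0 (πA.br (X 1) (X 0)))
  let τ₂ := RelPoissonEnv.i πR πA (polyC k R) (pderiv 1 (πA.br (X 1) (X 0)))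
  let τ₀ := relCoeffDeriv πR πA (πA.br (X 1) (X 0))
  let y : Fin 2 → Module.End k (ℕ × ℕ →₀ RelPoissonEnv πR πA (polyC k R)) :=
    fun r => IsCrossing.varOp (crossσ hf) (crossδ hf) τ₁ τ₂ τ₀ r
  have hy : ∀ r u, y r * relMulOp πR πA u = relMulOp πR πA (crossσ hf r 0 u) * y 0 +
      relMulOp πR πA (crossσ hf r 1 u) * y 1 + relMulOp πR πA (crossδ hf r u) := by
    intro r u
    apply LinearMap.ext
    intro v
    exact IsCrossing.varOp_smul τ₁ τ₂ τ₀ hc r u v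
  obtain ⟨ρ, h1, h2⟩ := exists_lift_toEnv (φ := relMulOp πR πA) (y := y) hf hy (by
    have h1 : ∀ p, lieDefect πA (liftDer (relMulOp πR πA) y) (X 1) (X 0)
        (Finsupp.single p 1) = 0 := by
      intro p
      have h : y 1 (y 0 (Finsupp.single p 1)) = _ :=
        IsCrossing.varOp_relation_single_one τ₁ τ₂ τ₀ hc p
      rw [lieDefect_liftDer_X_X]
      simp only [LinearMap.sub_apply, LinearMap.add_apply, Module.End.mul_apply, relMulOp_apply]
      rw [h]
      simp only [y]
      abel
    apply LinearMap.ext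
    intro v
    induction v using Finsupp.induction_linear with
    | zero => rw [map_zero, map_zero]
    | add v w hv hw => rw [map_add, hv, hw, map_add]
    | single p u =>
      -- The defect is not linear over the relative algebra, but `Ω u = v Ω` still carries its
      -- vanishing from a unit vector to that vector with coefficient `u`.
      obtain ⟨v, hv⟩ := exists_lieDefect_mul (φ := relMulOp πR πA) (y := y) hf hy u
      have h2 := LinearMap.congr_fun hv (Finsupp.single p 1)
      rw [Module.End.mul_apply, Module.End.mul_apply, h1, map_zero, relMulOp_apply,
        Finsupp.smul_single, smul_eq_mul, mul_one] at h2
      exact h2)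
  refine ⟨ρ, fun u v => by rw [h1]; rfl, fun m n => ?_⟩
  rw [map_mul, map_pow, map_pow, h2, h2]
  exact IsCrossing.varOp_pow_single τ₁ τ₂ τ₀ hc m n

/-- Applying a sum of ordered monomials to the vector at `(0, 0)` returns its coefficient function.
-/
theorem env_basis_injective : Function.Injective
    (fun c : ℕ × ℕ →₀ RelPoissonEnv πR πA (polyC k R) => c.sum fun p s =>
      toEnv hf s * (dVar πA 0 ^ p.1 * dVar πA 1 ^ p.2)) := by
  obtain ⟨ρ, h1, h2⟩ := exists_envRep hf
  have key : ∀ c : ℕ × ℕ →₀ RelPoissonEnv πR πA (polyC k R),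
      ρ (c.sum fun p s => toEnv hf s * (dVar πA 0 ^ p.1 * dVar πA 1 ^ p.2))
        (Finsupp.single (0, 0) 1) = c := by
    intro c
    rw [Finsupp.sum, map_sum, LinearMap.sum_apply]
    conv_rhs => rw [← Finsupp.sum_single c, Finsupp.sum]
    refine Finset.sum_congr rfl fun p _ => ?_
    rw [map_mul, Module.End.mul_apply, h2, h1, Finsupp.smul_single, smul_eq_mul, mul_one]
  intro c c' h
  rw [← key c, ← key c']
  exact congrArg (fun z => ρ z _) h

theorem toEnv_injective : Function.Injective (toEnv hf) := by
  intro s t h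
  have := env_basis_injective hf (a₁ := Finsupp.single (0, 0) s)
    (a₂ := Finsupp.single (0, 0) t) (by simp [h])
  exact Finsupp.single_injective _ this

theorem env_d_eq (p : MvPolynomial (Fin 2) R) : PoissonEnv.d πA p =
    toEnv hf (RelPoissonEnv.i πR πA _ (pderiv 0 p)) * dVar πA 0 +
      toEnv hf (RelPoissonEnv.i πR πA _ (pderiv 1 p)) * dVar πA 1 +
      toEnv hf (relCoeffDeriv πR πA p) :=
  derivation_eq (toEnv hf) (PoissonEnv.d πA)
    (fun p q => by rw [toEnv_i, toEnv_i, (PoissonEnv.satisfiesP πA).mul])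
    (fun a => (toEnv_d hf a).symm) p

/-- On generators these are relations of `A^e` with differentials expanded by the chain rule; the
crossing identities propagate them to products. -/
theorem dVar_mul (r : Fin 2) (u : RelPoissonEnv πR πA (polyC k R)) :
    dVar πA r * toEnv hf u = toEnv hf (crossσ hf r 0 u) * dVar πA 0 +
      toEnv hf (crossσ hf r 1 u) * dVar πA 1 + toEnv hf (crossδ hf r u) := by
  induction u using RelPoissonEnv.induction generalizing r with
  | hi p =>
    have h := (PoissonEnv.satisfiesP πA).bracket (X r) p
    rw [crossσ_i, crossσ_i, crossδ_i, toEnv_i hf (πA.br _ _), h, toEnv_i]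
    fin_cases r <;> simp [toEnv_i, dVar]
  | hd a =>
    have h := (PoissonEnv.satisfiesP πA).lie (X r) (polyC k R a)
    rw [env_d_eq hf (πA.br _ _), eq_sub_iff_add_eq] at h
    rw [toEnv_d, dVar, ← h, crossσ_d, crossσ_d, crossδ_d]
    fin_cases r <;> simp [add_mul, toEnv_d, dVar] <;> abel
  | hadd u v hu hv =>
    rw [map_add, mul_add, hu, hv]
    simp only [map_add, add_mul]
    abel
  | hmul u v hu hv =>
    have hc := isCrossing_cross hf
    rw [map_mul, ← mul_assoc, hu, hc.σ_mul, hc.σ_mul, hc.δ_mul, add_mul, add_mul, mul_assoc,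
      mul_assoc, hv, hv]
    simp only [map_add, map_mul, mul_add, add_mul, mul_assoc]
    abel

theorem env_generates :
    Algebra.adjoin k (Set.range (toEnv hf) ∪ {dVar πA 0, dVar πA 1}) = ⊤ := by
  rw [eq_top_iff]
  rintro u -
  have hB : ∀ b, toEnv hf b ∈
      Algebra.adjoin k (Set.range (toEnv hf) ∪ {dVar πA 0, dVar πA 1}) :=
    fun b => Algebra.subset_adjoin (Or.inl ⟨_, rfl⟩)
  induction u using PoissonEnv.induction with
  | hi p => rw [← toEnv_i hf]; exact hB _
  | hd p =>
    rw [env_d_eq hf]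
    exact add_mem (add_mem
      (mul_mem (hB _) (Algebra.subset_adjoin (Or.inr (Or.inl rfl))))
      (mul_mem (hB _) (Algebra.subset_adjoin (Or.inr (Or.inr rfl))))) (hB _)
  | hadd u v hu hv => exact add_mem hu hv
  | hmul u v hu hv => exact mul_mem hu hv

theorem dVar_relation : dVar πA 1 * dVar πA 0 = dVar πA 0 * dVar πA 1 +
    toEnv hf (RelPoissonEnv.i πR πA _ (pderiv 0 (πA.br (X 1) (X 0)))) * dVar πA 0 +
    toEnv hf (RelPoissonEnv.i πR πA _ (pderiv 1 (πA.br (X 1) (X 0)))) * dVar πA 1 +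
    toEnv hf (relCoeffDeriv πR πA (πA.br (X 1) (X 0))) := by
  have h := (PoissonEnv.satisfiesP πA).lie (X 1) (X 0)
  rw [env_d_eq hf, eq_sub_iff_add_eq] at h
  simp only [dVar] at h ⊢
  rw [← h]
  abel

/-- `A^e` is a left double extension of the relative enveloping algebra of `R → A`. -/
theorem env_isLeftDoubleExtension : IsLeftDoubleExtension (toEnv hf) (dVar πA) where
  injective := toEnv_injective hf
  generates := env_generates hf
  relation := ⟨0, 1, _, _, _, by rw [zero_smul, zero_add, one_smul]; exact dVar_relation hf⟩
  basis := ⟨env_basis_injective hf, fun t => exists_left_sum (env_generates hf)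
    (fun r s => ⟨_, _, _, dVar_mul hf r s⟩) (dVar_relation hf) t⟩
  subset a b c := by
    refine ⟨crossσ hf 0 0 a + crossσ hf 1 0 b, crossσ hf 0 1 a + crossσ hf 1 1 b,
      crossδ hf 0 a + crossδ hf 1 b + c, ?_⟩
    rw [dVar_mul, dVar_mul]
    simp only [map_add, add_mul]
    abel

end EnvOverRelEnv

/-! ### Identification with `B`, the symmetric halves, and commutation formulas -/

namespace IsDoublePoissonOre

open MvPolynomial

variable {k R : Type*} [CommRing k] [CommRing R] [Algebra k R]
  {πR : PoissonBracket k R} {πA : PoissonBracket k (MvPolynomial (Fin 2) R)}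
  {Q : k × k} {α : R → Matrix (Fin 2) (Fin 2) R} {ν : R → Fin 2 → R} {w : R × R × R}

theorem envMap_i (h : IsDoublePoissonOre πR πA Q α ν w) (a : R) :
    h.envMap (PoissonEnv.i πR a) = PoissonEnv.i πA (polyC k R a) := by
  simp [envMap, PoissonEnv.map]

theorem envMap_d (h : IsDoublePoissonOre πR πA Q α ν w) (a : R) :
    h.envMap (PoissonEnv.d πR a) = PoissonEnv.d πA (polyC k R a) := by
  simp [envMap, PoissonEnv.map]

theorem coe_toMid (h : IsDoublePoissonOre πR πA Q α ν w) (s : PoissonEnv πR) :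
    (h.toMid s : PoissonEnv πA) = h.envMap s := rfl

theorem coe_x (h : IsDoublePoissonOre πR πA Q α ν w) (r : Fin 2) :
    (h.x r : PoissonEnv πA) = PoissonEnv.i πA (X r) := by
  fin_cases r <;> rfl

theorem coe_iB (h : IsDoublePoissonOre πR πA Q α ν w) (a : R) :
    (h.iB a : PoissonEnv πA) = PoissonEnv.i πA (polyC k R a) :=
  h.envMap_i a

theorem coe_dB (h : IsDoublePoissonOre πR πA Q α ν w) (a : R) :
    (h.dB a : PoissonEnv πA) = PoissonEnv.d πA (polyC k R a) :=
  h.envMap_d a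

theorem y_apply (h : IsDoublePoissonOre πR πA Q α ν w) (r : Fin 2) :
    h.y r = PoissonEnv.d πA (X r) := by
  fin_cases r <;> rfl

/-- An algebra which embeds in `A^e` and is generated by a copy of `R^e` and `x₁`, `x₂` is
isomorphic to `B`. -/
theorem exists_equiv_mid (h : IsDoublePoissonOre πR πA Q α ν w) {S T : Type*} [Ring S]
    [Algebra k S] [Ring T] [Algebra k T] (eS : S ≃ₐ[k] PoissonEnv πR) (j : S →ₐ[k] T)
    (t : Fin 2 → T) (hgen : Algebra.adjoin k (Set.range j ∪ {t 0, t 1}) = ⊤)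
    (g : T →ₐ[k] PoissonEnv πA) (hg : Function.Injective g)
    (hj : ∀ s, h.envMap (eS s) = g (j s)) (ht : ∀ r, PoissonEnv.i πA (X r) = g (t r)) :
    ∃ e : T ≃ₐ[k] h.mid, ∀ z, (e z : PoissonEnv πA) = g z := by
  have hr : g.range = h.mid := by
    rw [← Algebra.map_top, ← hgen, AlgHom.map_adjoin,
      image_range_union_pair j t h.envMap (fun r => PoissonEnv.i πA (X r)) eS g hj ht]
    rfl
  exact ⟨(AlgEquiv.ofInjective g hg).trans (Subalgebra.equivOfEq _ _ hr), fun z => rfl⟩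

theorem toEnv_ofEnv (h : IsDoublePoissonOre πR πA Q α ν w) (s : PoissonEnv πR) :
    RelPoissonEnv.toEnv h.br_base (RelPoissonEnv.ofEnv h.br_base s) = h.envMap s := by
  have : (RelPoissonEnv.toEnv h.br_base).comp (RelPoissonEnv.ofEnv h.br_base) = h.envMap :=
    PoissonEnv.algHom_ext
      (fun a => by rw [AlgHom.comp_apply, ofEnv_i, toEnv_i, envMap_i])
      (fun a => by rw [AlgHom.comp_apply, ofEnv_d, toEnv_d, envMap_d])
  exact DFunLike.congr_fun this s

/-- Freeness of `A^e` over the relative algebra is used here: it makes the map to `A^e` injective,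
so `B` satisfies no further relations. -/
theorem exists_relPoissonEnv_equiv_mid (h : IsDoublePoissonOre πR πA Q α ν w) :
    ∃ e : RelPoissonEnv πR πA (polyC k R) ≃ₐ[k] h.mid,
      ∀ z, (e z : PoissonEnv πA) = RelPoissonEnv.toEnv h.br_base z :=
  h.exists_equiv_mid AlgEquiv.refl (RelPoissonEnv.ofEnv h.br_base) (relVar πR πA)
    (relEnv_generates h.br_base) _ (toEnv_injective h.br_base)
    (fun s => (h.toEnv_ofEnv s).symm) (fun r => (toEnv_i h.br_base (X r)).symm)

theorem isRightDoubleExtension_toMid (h : IsDoublePoissonOre πR πA Q α ν w) :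
    IsRightDoubleExtension h.toMid h.x := by
  obtain ⟨e, he⟩ := h.exists_relPoissonEnv_equiv_mid
  refine (relEnv_isRightDoubleExtension h.br_base
    fun a r => ⟨_, _, _, h.br_mixed a r⟩).transport AlgEquiv.refl e (fun s => ?_) (fun r => ?_)
  · apply Subtype.ext
    rw [he, toEnv_ofEnv]
    rfl
  · apply Subtype.ext
    rw [he, coe_x, relVar, toEnv_i]

theorem isLeftDoubleExtension_mid (h : IsDoublePoissonOre πR πA Q α ν w) :
    IsLeftDoubleExtension h.mid.val h.y := by
  obtain ⟨e, he⟩ := h.exists_relPoissonEnv_equiv_mid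
  exact (env_isLeftDoubleExtension h.br_base).transport e AlgEquiv.refl he h.y_apply

/-- Changing the sign of the brackets gives a double Poisson-Ore extension again. -/
theorem neg (h : IsDoublePoissonOre πR πA Q α ν w) :
    IsDoublePoissonOre πR.neg πA.neg (-Q) (fun a => -α a) (fun a => -ν a) (-w) where
  br_base a b := by simp [h.br_base]
  br_vars := by
    simp only [PoissonBracket.neg_br, h.br_vars, quadraticPart, Prod.fst_neg, Prod.snd_neg,
      map_neg, neg_smul, neg_mul]
    ring
  br_mixed a r := by
    simp only [PoissonBracket.neg_br, h.br_mixed, Matrix.neg_apply, Pi.neg_apply, map_neg, neg_mul]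
    ring

theorem opEquiv_envMap (h : IsDoublePoissonOre πR πA Q α ν w) (s : (PoissonEnv πR.neg)ᵐᵒᵖ) :
    h.envMap (PoissonEnv.opEquiv πR s) =
      PoissonEnv.opEquiv πA (AlgHom.op h.neg.envMap s) := by
  induction s using MulOpposite.rec' with
  | h s =>
  change h.envMap (PoissonEnv.opEquiv πR (MulOpposite.op s)) =
    PoissonEnv.opEquiv πA (MulOpposite.op (h.neg.envMap s))
  induction s using PoissonEnv.induction with
  | hi a => rw [PoissonEnv.opEquiv_i, envMap_i, envMap_i, PoissonEnv.opEquiv_i]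
  | hd a => rw [PoissonEnv.opEquiv_d, envMap_d, envMap_d, PoissonEnv.opEquiv_d]
  | hadd u v hu hv => simp only [MulOpposite.op_add, map_add, hu, hv]
  | hmul u v hu hv => simp only [MulOpposite.op_mul, map_mul, hu, hv]

/-- The isomorphism `opEquiv` matches the generators of the two subalgebras, so it restricts to
them. -/
theorem exists_op_equiv_mid (h : IsDoublePoissonOre πR πA Q α ν w) :
    ∃ e : (h.neg.mid)ᵐᵒᵖ ≃ₐ[k] h.mid,
      ∀ z, (e z : PoissonEnv πA) = PoissonEnv.opEquiv πA (AlgHom.op h.neg.mid.val z) := by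
  refine h.exists_equiv_mid (PoissonEnv.opEquiv πR) (AlgHom.op h.neg.toMid)
    (fun r => MulOpposite.op (h.neg.x r))
    (adjoin_op_eq_top h.neg.isRightDoubleExtension_toMid.generates)
    ((PoissonEnv.opEquiv πA).toAlgHom.comp (AlgHom.op h.neg.mid.val)) ?_ (fun s => ?_)
    (fun r => ?_)
  · exact (PoissonEnv.opEquiv πA).injective.comp (injective_op Subtype.val_injective)
  · exact h.opEquiv_envMap s
  · change _ = PoissonEnv.opEquiv πA (MulOpposite.op (h.neg.x r : PoissonEnv πA.neg))
    rw [coe_x, PoissonEnv.opEquiv_i]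

/-- The right-hand result for the negated brackets, read in the opposite algebras. -/
theorem isLeftDoubleExtension_toMid (h : IsDoublePoissonOre πR πA Q α ν w) :
    IsLeftDoubleExtension h.toMid h.x := by
  obtain ⟨e, he⟩ := h.exists_op_equiv_mid
  refine h.neg.isRightDoubleExtension_toMid.op.transport (PoissonEnv.opEquiv πR) e (fun s => ?_)
    (fun r => ?_)
  · apply Subtype.ext
    rw [he]
    exact h.opEquiv_envMap s
  · apply Subtype.ext
    rw [he, coe_x]
    change _ = PoissonEnv.opEquiv πA (MulOpposite.op (h.neg.x r : PoissonEnv πA.neg))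
    rw [coe_x, PoissonEnv.opEquiv_i]

theorem isRightDoubleExtension_mid (h : IsDoublePoissonOre πR πA Q α ν w) :
    IsRightDoubleExtension h.mid.val h.y := by
  obtain ⟨e, he⟩ := h.exists_op_equiv_mid
  refine h.neg.isLeftDoubleExtension_mid.op.transport e (PoissonEnv.opEquiv πA) he (fun r => ?_)
  rw [y_apply, y_apply, PoissonEnv.opEquiv_d]

theorem x_mul_i (h : IsDoublePoissonOre πR πA Q α ν w) (r : Fin 2) (a : R) :
    h.x r * h.toMid (PoissonEnv.i πR a) = h.toMid (PoissonEnv.i πR a) * h.x r := by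
  apply Subtype.ext
  simp only [MulMemClass.coe_mul, coe_toMid, coe_x, envMap_i, ← map_mul, mul_comm]

theorem x_mul_d (h : IsDoublePoissonOre πR πA Q α ν w) (r : Fin 2) (a : R) :
    h.x r * h.toMid (PoissonEnv.d πR a) = h.toMid (PoissonEnv.d πR a) * h.x r +
      (h.toMid (PoissonEnv.i πR (α a r 0)) * h.x 0 + h.toMid (PoissonEnv.i πR (α a r 1)) * h.x 1 +
        h.toMid (PoissonEnv.i πR (ν a r))) := by
  apply Subtype.ext
  simp only [MulMemClass.coe_mul, AddMemClass.coe_add, coe_toMid, coe_x, envMap_i, envMap_d,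
    ← map_mul, ← map_add]
  rw [← h.br_mixed, πA.br_skew, map_neg, (PoissonEnv.satisfiesP πA).bracket]
  abel

theorem y_mul_iB (h : IsDoublePoissonOre πR πA Q α ν w) (r : Fin 2) (a : R) :
    h.y r * h.mid.val (h.iB a) = h.mid.val (h.iB a) * h.y r +
      h.mid.val (h.iB (α a r 0) * h.x 0 + h.iB (α a r 1) * h.x 1 + h.iB (ν a r)) := by
  simp only [Subalgebra.coe_val, MulMemClass.coe_mul, AddMemClass.coe_add, coe_iB, coe_x, y_apply,
    ← map_mul, ← map_add]
  rw [← h.br_mixed, (PoissonEnv.satisfiesP πA).bracket]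
  abel

theorem y_mul_dB (h : IsDoublePoissonOre πR πA Q α ν w) (r : Fin 2) (a : R) :
    h.y r * h.mid.val (h.dB a) = h.mid.val (h.dB a) * h.y r +
      (h.mid.val (h.iB (α a r 0)) * h.y 0 + h.mid.val (h.iB (α a r 1)) * h.y 1 +
      h.mid.val (h.x 0 * h.dB (α a r 0) + h.x 1 * h.dB (α a r 1) + h.dB (ν a r))) := by
  have h1 := (PoissonEnv.satisfiesP πA).lie (X r) (polyC k R a)
  rw [h.br_mixed, map_add, map_add, (PoissonEnv.satisfiesP πA).mul,
    (PoissonEnv.satisfiesP πA).mul, eq_sub_iff_add_eq] at h1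
  simp only [Subalgebra.coe_val, MulMemClass.coe_mul, AddMemClass.coe_add, coe_iB, coe_dB, coe_x,
    y_apply]
  rw [← h1]
  abel

theorem coe_quadraticPart (h : IsDoublePoissonOre πR πA Q α ν w) :
    ((quadraticPart h.iB h.x Q w : h.mid) : PoissonEnv πA) = PoissonEnv.i πA (πA.br (X 1) (X 0)) := by
  rw [h.br_vars]
  simp [quadraticPart, coe_iB, coe_x]

theorem y_mul_x (h : IsDoublePoissonOre πR πA Q α ν w) (r l : Fin 2) :
    h.y r * h.mid.val (h.x l) = h.mid.val (h.x l) * h.y r +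
      PoissonEnv.i πA (πA.br (X r) (X l)) := by
  rw [Subalgebra.coe_val, coe_x, y_apply, (PoissonEnv.satisfiesP πA).bracket]
  abel

/-- This is `[dx₂, dx₁] = d{x₂, x₁}` expanded by the product rule; the factor 2 comes from `d(x₁ ^
2)`. -/
theorem y_relation (h : IsDoublePoissonOre πR πA Q α ν w) : h.y 1 * h.y 0 = h.y 0 * h.y 1 +
    h.mid.val ((2 * Q.1) • h.x 0 + Q.2 • h.x 1 + h.iB w.1) * h.y 0 +
    h.mid.val (Q.2 • h.x 0 + h.iB w.2.1) * h.y 1 +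
    h.mid.val (h.x 0 * h.dB w.1 + h.x 1 * h.dB w.2.1 + h.dB w.2.2) := by
  have h1 := (PoissonEnv.satisfiesP πA).lie (X 1) (X 0)
  rw [h.br_vars, quadraticPart, eq_sub_iff_add_eq] at h1
  simp only [map_add, map_smul, pow_two, (PoissonEnv.satisfiesP πA).mul] at h1
  simp only [Subalgebra.coe_val, MulMemClass.coe_mul, AddMemClass.coe_add, coe_iB, coe_dB, coe_x,
    SetLike.val_smul, y_apply, two_mul, add_smul, add_mul, smul_mul_assoc]
  rw [← h1]
  simp only [smul_add]
  abel

end IsDoublePoissonOre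

/-! ### Assembly of the theorem -/

theorem theorem2p1 {k R : Type*} [Field k] [CharZero k] [CommRing R] [Algebra k R]
    (πR : PoissonBracket k R) (πA : PoissonBracket k (MvPolynomial (Fin 2) R))
    (q₁₁ q₁₂ : k) (α : R → Matrix (Fin 2) (Fin 2) R) (ν : R → Fin 2 → R) (w₁ w₂ w₀ : R)
    (h : IsDoublePoissonOre πR πA (q₁₁, q₁₂) α ν (w₁, w₂, w₀)) :
    -- `B` is a double extension of `R^e` with the variables `x₁, x₂`
    IsDoubleExtension h.toMid h.x ∧
    -- `A^e` is a double extension of `B` with the variables `y₁ = d x₁, y₂ = d x₂`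
    IsDoubleExtension h.mid.val h.y ∧
    -- the DE-data of `B` over `R^e`
    (∃ (σ : PoissonEnv πR →ₗ[k] Matrix (Fin 2) (Fin 2) (PoissonEnv πR))
        (δ : PoissonEnv πR →ₗ[k] (Fin 2 → PoissonEnv πR)),
      HasDEData h.toMid h.x (0, 1) σ δ (0, 0, 0) ∧
      ∀ a : R,
        σ (PoissonEnv.i πR a) = !![PoissonEnv.i πR a, 0; 0, PoissonEnv.i πR a] ∧
        σ (PoissonEnv.d πR a) =
          !![PoissonEnv.i πR (α a 0 0) + PoissonEnv.d πR a, PoissonEnv.i πR (α a 0 1);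
             PoissonEnv.i πR (α a 1 0), PoissonEnv.i πR (α a 1 1) + PoissonEnv.d πR a] ∧
        δ (PoissonEnv.i πR a) = ![0, 0] ∧
        δ (PoissonEnv.d πR a) = ![PoissonEnv.i πR (ν a 0), PoissonEnv.i πR (ν a 1)]) ∧
    -- the DE-data of `A^e` over `B`
    (∃ (σ : h.mid →ₗ[k] Matrix (Fin 2) (Fin 2) h.mid) (δ : h.mid →ₗ[k] (Fin 2 → h.mid)),
      HasDEData h.mid.val h.y (0, 1) σ δ
        ((2 * q₁₁) • h.x 0 + q₁₂ • h.x 1 + h.iB w₁,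
          q₁₂ • h.x 0 + h.iB w₂,
          h.x 0 * h.dB w₁ + h.x 1 * h.dB w₂ + h.dB w₀) ∧
      (∀ a : R,
        σ (h.iB a) = !![h.iB a, 0; 0, h.iB a] ∧
        σ (h.dB a) =
          !![h.iB (α a 0 0) + h.dB a, h.iB (α a 0 1);
             h.iB (α a 1 0), h.iB (α a 1 1) + h.dB a] ∧
        δ (h.iB a) =
          ![h.iB (α a 0 0) * h.x 0 + h.iB (α a 0 1) * h.x 1 + h.iB (ν a 0),
            h.iB (α a 1 0) * h.x 0 + h.iB (α a 1 1) * h.x 1 + h.iB (ν a 1)] ∧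
        δ (h.dB a) =
          ![h.x 0 * h.dB (α a 0 0) + h.x 1 * h.dB (α a 0 1) + h.dB (ν a 0),
            h.x 0 * h.dB (α a 1 0) + h.x 1 * h.dB (α a 1 1) + h.dB (ν a 1)]) ∧
      σ (h.x 0) = !![h.x 0, 0; 0, h.x 0] ∧
      σ (h.x 1) = !![h.x 1, 0; 0, h.x 1] ∧
      δ (h.x 0) = ![0, quadraticPart h.iB h.x (q₁₁, q₁₂) (w₁, w₂, w₀)] ∧
      δ (h.x 1) = ![-quadraticPart h.iB h.x (q₁₁, q₁₂) (w₁, w₂, w₀), 0]) := by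
  refine ⟨⟨h.isLeftDoubleExtension_toMid, h.isRightDoubleExtension_toMid⟩,
    ⟨h.isLeftDoubleExtension_mid, h.isRightDoubleExtension_mid⟩, ?_, ?_⟩
  · obtain ⟨σ, δ, hc, hv⟩ := h.isLeftDoubleExtension_toMid.exists_crossing
    refine ⟨σ, δ, ⟨?_, hc⟩, fun a => ?_⟩
    · have hx : h.x 1 * h.x 0 = h.x 0 * h.x 1 := by
        apply Subtype.ext
        simp only [MulMemClass.coe_mul, h.coe_x, ← map_mul, mul_comm]
      simp [hx]
    -- The vectors passed to `hv` are the two columns of `σ` followed by `δ`; uniqueness of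
    -- coefficients turns the commutation relation into their values.
    · obtain ⟨h1, h2⟩ := hv (PoissonEnv.i πR a) ![PoissonEnv.i πR a, 0] ![0, PoissonEnv.i πR a]
        ![0, 0] (fun r => by
          rw [h.x_mul_i]
          fin_cases r <;> simp)
      obtain ⟨h3, h4⟩ := hv (PoissonEnv.d πR a)
        ![PoissonEnv.i πR (α a 0 0) + PoissonEnv.d πR a, PoissonEnv.i πR (α a 1 0)]
        ![PoissonEnv.i πR (α a 0 1), PoissonEnv.i πR (α a 1 1) + PoissonEnv.d πR a]
        ![PoissonEnv.i πR (ν a 0), PoissonEnv.i πR (ν a 1)] (fun r => by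
          rw [h.x_mul_d]
          fin_cases r <;> simp [add_mul] <;> abel)
      exact ⟨h1, h3, h2, h4⟩
  · obtain ⟨σ, δ, hc, hv⟩ := h.isLeftDoubleExtension_mid.exists_crossing
    refine ⟨σ, δ, ⟨?_, hc⟩, fun a => ?_, ?_⟩
    · rw [zero_smul, zero_add, one_smul]
      exact h.y_relation
    · obtain ⟨h1, h2⟩ := hv (h.iB a) ![h.iB a, 0] ![0, h.iB a]
        ![h.iB (α a 0 0) * h.x 0 + h.iB (α a 0 1) * h.x 1 + h.iB (ν a 0),
          h.iB (α a 1 0) * h.x 0 + h.iB (α a 1 1) * h.x 1 + h.iB (ν a 1)] (fun r => by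
          rw [h.y_mul_iB]
          fin_cases r <;> simp)
      obtain ⟨h3, h4⟩ := hv (h.dB a)
        ![h.iB (α a 0 0) + h.dB a, h.iB (α a 1 0)] ![h.iB (α a 0 1), h.iB (α a 1 1) + h.dB a]
        ![h.x 0 * h.dB (α a 0 0) + h.x 1 * h.dB (α a 0 1) + h.dB (ν a 0),
          h.x 0 * h.dB (α a 1 0) + h.x 1 * h.dB (α a 1 1) + h.dB (ν a 1)] (fun r => by
          rw [h.y_mul_dB]
          fin_cases r <;> simp [add_mul] <;> abel)
      exact ⟨h1, h3, h2, h4⟩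
    -- `δ` at a variable `x_l` has entries `{x_r, x_l}`: the diagonal one vanishes and the other is
    -- the quadratic polynomial up to sign.
    · obtain ⟨h1, h2⟩ := hv (h.x 0) ![h.x 0, 0] ![0, h.x 0]
        ![0, quadraticPart h.iB h.x (q₁₁, q₁₂) (w₁, w₂, w₀)] (fun r => by
          rw [h.y_mul_x]
          fin_cases r <;> simp [h.coe_quadraticPart, πA.br_self])
      obtain ⟨h3, h4⟩ := hv (h.x 1) ![h.x 1, 0] ![0, h.x 1]
        ![-quadraticPart h.iB h.x (q₁₁, q₁₂) (w₁, w₂, w₀), 0] (fun r => by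
          rw [h.y_mul_x]
          fin_cases r <;>
            simp [h.coe_quadraticPart, πA.br_self, πA.br_skew (MvPolynomial.X 0)])
      exact ⟨h1, h3, h2, h4⟩
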